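/- Let $d\ge 2$ be an integer. A state is a positive semidefinite operator of unit trace. For a real number $q\in[-\frac1{d^2-1},1]$ let $\Phi_q=q\,\mathrm{Id}+(1-q)\,\mathrm{Tr}$, where $\mathrm{Tr}[X]=\operatorname{tr}(X)\,\frac1d I_d$, be the depolarizing channel on $d\times d$ complex matrices. A channel (completely positive trace-preserving linear map) $\Phi$ on a bipartite system $AB$ is called entanglement-annihilating (EA) if $\Phi[\varrho]$ is separable with respect to $A|B$ (a finite convex combination of products of states) for every state $\varrho$; a channel $\Phi$ on a system $S$ is called entanglement-breaking (EB) if $(\Phi\otimes\mathrm{Id}^E)[\omega]$ is separable with respect to $S|E$ for every finite-dimensional $E$ and every state $\omega$ of $SE$; a channel $\Phi$ is called 2-locally EA if $\Phi\otimes\Phi$ is EA. For real $s,t$ let $\Lambda_{st}$ be the linear map on operators on $\mathbb C^d\otimes\mathbb C^d$ with $\Lambda_{st}[I\otimes I]=I\otimes I$, $\Lambda_{st}[Z\otimes I]=s\,Z\otimes I$, $\Lambda_{st}[I\otimes Z]=s\,I\otimes Z$ and $\Lambda_{st}[Z\otimes W]=t\,Z\otimes W$ for all traceless $Z,W$. (1)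 Let $q_1,q_2\in[-\frac1{d^2-1},1]$ satisfy $$(d^2-1)\,q_1q_2\le 1+\frac{(d-2)(d+1)}{d+2}\,(q_1+q_2).$$ Then there are $\mu\in[0,1]$, $p\in[-\frac1{d^2-1},\frac1{d+1}]$ and real $s_1,t_1,s_2,t_2$ such that $\Phi_p$ is EB, the maps $\Lambda_{s_1t_1}$ and $\Lambda_{s_2t_2}$ are positive, and $$\Phi_{q_1}\otimes\Phi_{q_2}=\mu\,(\Phi_p\otimes\mathrm{Id})\circ\Lambda_{s_1t_1}+(1-\mu)\,(\mathrm{Id}\otimes\Phi_p)\circ\Lambda_{s_2t_2};\qquad(*)$$ moreover, the channel $\Phi_{q_1}\otimes\Phi_{q_2}$ is EA. (2) If equality holds in the inequality of (1) and $q_1,q_2<1$, then $(*)$ holds, with $\mu\in[0,1]$, $\Phi_p$ EB and $\Lambda_{s_1t_1},\Lambda_{s_2t_2}$ positive, for the explicit parameters $p=\frac1{d+1}$, $\mu=\frac12+\frac{d+1}{2d}(q_2-q_1)$, $$s_1=\frac{2(d+1)}{d+2}\cdot\frac{(d+1)q_2-q_1}{d+(d+1)(q_2-q_1)},\qquad s_2=\frac{2(d+1)}{d+2}\cdot\frac{(d+1)q_1-q_2}{d+(d+1)(q_1-q_2)},$$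 and $t_i=\frac1{d-1}+\bigl(1-\frac1{d-1}\bigr)s_i$ for $i=1,2$. (3) In particular, $\Phi_q$ is 2-locally EA for every real $q$ with $$-\frac1{d^2-1}\le q\le\frac{d-2+d\sqrt{\frac{2d}{d+1}}}{(d-1)(d+2)}.$$ -/

import Mathlib

open scoped Kronecker ComplexOrder

noncomputable section

/-- Linear maps between the operator spaces of two finite-dimensional quantum systems, whose
Hilbert spaces are `ℂ^m` and `ℂ^n`. -/
abbrev OpMap (m n : Type) : Type := Matrix m m ℂ →ₗ[ℂ] Matrix n n ℂ

/-- The tensor product `Φ ⊗ Ψ` of two linear maps on operators, given by its values on the matrix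
units `|i⟩⟨j| ⊗ |k⟩⟨l|`. -/
def tensorMap {m n m' n' : Type} [Fintype m] [Fintype m'] [DecidableEq m] [DecidableEq m']
    (Φ : OpMap m n) (Ψ : OpMap m' n') : OpMap (m × m') (n × n') where
  toFun X := ∑ i, ∑ j, ∑ k, ∑ l,
    X (i, k) (j, l) • (Φ (Matrix.single i j 1) ⊗ₖ Ψ (Matrix.single k l 1))
  map_add' X Y := by
    simp only [Matrix.add_apply, add_smul, Finset.sum_add_distrib]
  map_smul' c X := by
    simp only [Matrix.smul_apply, smul_eq_mul, mul_smul, Finset.smul_sum, RingHom.id_apply]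

/-- `(Φ ⊗ Ψ)[A ⊗ B] = Φ[A] ⊗ Ψ[B]`. -/
theorem tensorMap_kronecker {m n m' n' : Type} [Fintype m] [Fintype m'] [DecidableEq m]
    [DecidableEq m'] (Φ : OpMap m n) (Ψ : OpMap m' n') (A : Matrix m m ℂ) (B : Matrix m' m' ℂ) :
    tensorMap Φ Ψ (A ⊗ₖ B) = Φ A ⊗ₖ Ψ B := by
  have hA : Φ A = ∑ i, ∑ j, A i j • Φ (Matrix.single i j 1) := by
    conv_lhs => rw [Matrix.matrix_eq_sum_single A]
    simp only [map_sum]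
    refine Finset.sum_congr rfl fun i _ => Finset.sum_congr rfl fun j _ => ?_
    rw [← Φ.map_smul, Matrix.smul_single, smul_eq_mul, mul_one]
  have hB : Ψ B = ∑ k, ∑ l, B k l • Ψ (Matrix.single k l 1) := by
    conv_lhs => rw [Matrix.matrix_eq_sum_single B]
    simp only [map_sum]
    refine Finset.sum_congr rfl fun i _ => Finset.sum_congr rfl fun j _ => ?_
    rw [← Ψ.map_smul, Matrix.smul_single, smul_eq_mul, mul_one]
  ext ⟨a, b⟩ ⟨a', b'⟩
  rw [hA, hB]
  simp only [tensorMap, LinearMap.coe_mk, AddHom.coe_mk, Matrix.sum_apply, Matrix.smul_apply,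
    Matrix.kroneckerMap_apply, smul_eq_mul]
  simp only [Finset.sum_mul]
  simp only [Finset.mul_sum]
  refine Finset.sum_congr rfl fun i _ => Finset.sum_congr rfl fun j _ => ?_
  refine Finset.sum_congr rfl fun k _ => Finset.sum_congr rfl fun l _ => ?_
  ring

/-- Density operators: positive semidefinite with unit trace. -/
def IsDensity {m : Type} [Fintype m] (ρ : Matrix m m ℂ) : Prop :=
  ρ.PosSemidef ∧ ρ.trace = 1

/-- A bipartite operator is a separable state (with respect to the partition into the two factors)
if it is a convex combination `∑ⱼ pⱼ ρⱼ ⊗ σⱼ` of products of density operators. -/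
def IsSeparableState {m n : Type} [Fintype m] [Fintype n] (ω : Matrix (m × n) (m × n) ℂ) : Prop :=
  ∃ (N : ℕ) (p : Fin N → ℝ) (ρ : Fin N → Matrix m m ℂ) (σ : Fin N → Matrix n n ℂ),
    (∀ j, 0 ≤ p j) ∧ ∑ j, p j = 1 ∧ (∀ j, IsDensity (ρ j)) ∧ (∀ j, IsDensity (σ j)) ∧
    ω = ∑ j, (p j : ℂ) • (ρ j ⊗ₖ σ j)

/-- Positive maps: positive semidefinite operators are sent to positive semidefinite ones. -/
def IsPositiveMap {m n : Type} [Fintype m] [Fintype n] (Φ : OpMap m n) : Prop :=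
  ∀ X : Matrix m m ℂ, X.PosSemidef → (Φ X).PosSemidef

/-- Completely positive maps: `Φ ⊗ Id` is positive for every finite-dimensional ancilla. -/
def IsCompletelyPositiveMap {m n : Type} [Fintype m] [Fintype n] [DecidableEq m]
    (Φ : OpMap m n) : Prop :=
  ∀ k : ℕ, IsPositiveMap (tensorMap Φ (LinearMap.id : OpMap (Fin k) (Fin k)))

/-- Quantum channels: completely positive trace-preserving linear maps. -/
def IsChannel {m n : Type} [Fintype m] [Fintype n] [DecidableEq m] (Φ : OpMap m n) : Prop :=
  IsCompletelyPositiveMap Φ ∧ ∀ X : Matrix m m ℂ, (Φ X).trace = X.trace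

/-- Entanglement-breaking (EB) channels: `(Φ ⊗ Id)[ω]` is separable with respect to the partition
system | environment, for every environment and every joint state `ω`. -/
def IsEntanglementBreaking {m n : Type} [Fintype m] [Fintype n] [DecidableEq m]
    (Φ : OpMap m n) : Prop :=
  IsChannel Φ ∧ ∀ (k : ℕ) (ω : Matrix (m × Fin k) (m × Fin k) ℂ), IsDensity ω →
    IsSeparableState (tensorMap Φ (LinearMap.id : OpMap (Fin k) (Fin k)) ω)

/-- Entanglement-annihilating (EA) channels on a bipartite system: the output is separable for
every input state. -/
def IsEntanglementAnnihilating {m m' n n' : Type} [Fintype m] [Fintype m'] [Fintype n]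
    [Fintype n'] [DecidableEq m] [DecidableEq m'] (Φ : OpMap (m × m') (n × n')) : Prop :=
  IsChannel Φ ∧ ∀ ρ : Matrix (m × m') (m × m') ℂ, IsDensity ρ → IsSeparableState (Φ ρ)

/-- 2-locally entanglement-annihilating (2LEA) channels: channels `Φ` for which `Φ ⊗ Φ` is
entanglement-annihilating. -/
def IsTwoLocallyEA {m n : Type} [Fintype m] [Fintype n] [DecidableEq m] (Φ : OpMap m n) : Prop :=
  IsChannel Φ ∧ IsEntanglementAnnihilating (tensorMap Φ Φ)

/-- The trace map `X ↦ tr(X) I / d`. -/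
def traceMap (d : ℕ) : OpMap (Fin d) (Fin d) where
  toFun X := (X.trace / (d : ℂ)) • (1 : Matrix (Fin d) (Fin d) ℂ)
  map_add' X Y := by rw [Matrix.trace_add, add_div, add_smul]
  map_smul' c X := by
    rw [Matrix.trace_smul, RingHom.id_apply, smul_smul, smul_eq_mul, mul_div_assoc]

/-- The depolarizing map `Φ_q = q Id + (1 - q) Tr` on a `d`-dimensional system. -/
def depolarizing (d : ℕ) (q : ℝ) : OpMap (Fin d) (Fin d) :=
  (q : ℂ) • LinearMap.id + ((1 - q : ℝ) : ℂ) • traceMap d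

/-- The map `Λ_{st}` on a `d × d` system. Since `traceMap d` is the projection onto the span of `I`
along the traceless operators, `Λ_{st}` is the diagonal map which multiplies `I ⊗ I` by `1`,
`Z ⊗ I` and `I ⊗ Z` by `s`, and `Z ⊗ W` by `t`, for traceless `Z` and `W` (for example,
Gell-Mann matrices). -/
def lambdaMap (d : ℕ) (s t : ℝ) : OpMap (Fin d × Fin d) (Fin d × Fin d) :=
  tensorMap (traceMap d) (traceMap d)
    + (s : ℂ) • tensorMap (LinearMap.id - traceMap d) (traceMap d)
    + (s : ℂ) • tensorMap (traceMap d) (LinearMap.id - traceMap d)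
    + (t : ℂ) • tensorMap (LinearMap.id - traceMap d) (LinearMap.id - traceMap d)

/-- `traceMap d` fixes the identity (in positive dimension). -/
theorem traceMap_one (d : ℕ) (hd : d ≠ 0) : traceMap d 1 = 1 := by
  have h : (d : ℂ) ≠ 0 := Nat.cast_ne_zero.mpr hd
  simp [traceMap, h]

/-- `traceMap d` kills traceless operators. -/
theorem traceMap_traceless (d : ℕ) (Z : Matrix (Fin d) (Fin d) ℂ) (hZ : Z.trace = 0) :
    traceMap d Z = 0 := by
  simp [traceMap, hZ]

/-- The eigen-operators and eigenvalues of `Λ_{st}`. -/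
theorem lambdaMap_spec (d : ℕ) (hd : d ≠ 0) (s t : ℝ) (Z W : Matrix (Fin d) (Fin d) ℂ)
    (hZ : Z.trace = 0) (hW : W.trace = 0) :
    lambdaMap d s t (1 ⊗ₖ 1) = 1 ⊗ₖ 1 ∧
    lambdaMap d s t (Z ⊗ₖ 1) = (s : ℂ) • (Z ⊗ₖ 1) ∧
    lambdaMap d s t (1 ⊗ₖ Z) = (s : ℂ) • (1 ⊗ₖ Z) ∧
    lambdaMap d s t (Z ⊗ₖ W) = (t : ℂ) • (Z ⊗ₖ W) := by
  have h1 := traceMap_one d hd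
  have hz := traceMap_traceless d Z hZ
  have hw := traceMap_traceless d W hW
  refine ⟨?_, ?_, ?_, ?_⟩ <;>
    simp only [lambdaMap, LinearMap.add_apply, LinearMap.smul_apply, tensorMap_kronecker,
      LinearMap.sub_apply, LinearMap.id_apply, h1, hz, hw, sub_self, sub_zero,
      Matrix.kronecker_zero, Matrix.zero_kronecker, smul_zero, add_zero, zero_add]

/-- The decomposition
`Φ_{q₁} ⊗ Φ_{q₂} = μ (Φ_p ⊗ Id) ∘ Λ_{s₁t₁} + (1 - μ) (Id ⊗ Φ_p) ∘ Λ_{s₂t₂}`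
is a convex resolution of the local depolarizing map into positive maps `Λ_{st}` followed by the
one-sided entanglement-breaking depolarizing channel `Φ_p`. -/
def IsDepolarizingResolution (d : ℕ) (q₁ q₂ μ p s₁ t₁ s₂ t₂ : ℝ) : Prop :=
  0 ≤ μ ∧ μ ≤ 1 ∧
  -1 / ((d : ℝ) ^ 2 - 1) ≤ p ∧ p ≤ 1 / ((d : ℝ) + 1) ∧
  IsEntanglementBreaking (depolarizing d p) ∧
  IsPositiveMap (lambdaMap d s₁ t₁) ∧ IsPositiveMap (lambdaMap d s₂ t₂) ∧
  tensorMap (depolarizing d q₁) (depolarizing d q₂) =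
    (μ : ℂ) • (tensorMap (depolarizing d p) LinearMap.id ∘ₗ lambdaMap d s₁ t₁) +
    ((1 - μ : ℝ) : ℂ) • (tensorMap LinearMap.id (depolarizing d p) ∘ₗ lambdaMap d s₂ t₂)

end

/-! All maps involved act diagonally on the four sectors `I⊗I`, `Z⊗I`, `I⊗Z`, `Z⊗W`, so `(*)`
amounts to three scalar equations between eigenvalues (`tensorMap_depolarizing_eq`). What remains is
to know which `Λ_{st}` are positive, which `Φ_p` are EB, and how to solve these equations inside
those ranges.

Positivity: `Λ_{s,s²} = Φ_s ⊗ Φ_s` is positive for `-1/(d-1) ≤ s ≤ 1`. For `s ≥ 0` each factor is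
completely positive; for `s ≤ 0` each factor is so after a transposition, and the two transpositions
combine into a global one. Since `Λ_{st}` is affine in `(s,t)`, positivity extends to the region
between the parabola `t = s²` and its chord over `[-1/(d-1), 1]` (`isPositiveMap_lambdaMap`).

EB: both ends of the range of `p` are measure-and-prepare maps, obtained by averaging over vectors
of fourth roots of unity and adding a basis measurement.

Parameters: with `p = 1/(d+1)` and the same `Λ_{st}` in both terms, the equations force `s =
(d+1)(q₁+q₂)/(d+2)` and `t = (d+1)q₁q₂`; the hypothesis on `q₁, q₂` says exactly that `(s,t)` lies
below the chord. Pairs for which this choice fails have simpler resolutions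
(`hasResolutionParameters`).

Separability follows because each `Λ_{st}` sends states to states, on which the one-sided EB channel
acts. -/

/-- Two linear maps on a bipartite operator space agree if they agree on product operators. -/
theorem linearMap_ext_kronecker {m m' : Type} [Fintype m] [Fintype m'] [DecidableEq m]
    [DecidableEq m'] {V : Type*} [AddCommMonoid V] [Module ℂ V]
    {F G : Matrix (m × m') (m × m') ℂ →ₗ[ℂ] V}
    (h : ∀ (A : Matrix m m ℂ) (B : Matrix m' m' ℂ), F (A ⊗ₖ B) = G (A ⊗ₖ B)) : F = G := by
  refine LinearMap.ext fun X => ?_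
  have hs : ∀ (i j : m × m') (c : ℂ), Matrix.single i j c
      = c • (Matrix.single i.1 j.1 (1 : ℂ) ⊗ₖ Matrix.single i.2 j.2 (1 : ℂ)) := by
    intro i j c
    rw [Matrix.single_kronecker_single, Matrix.smul_single]
    simp
  rw [Matrix.matrix_eq_sum_single X]
  simp only [map_sum]
  refine Finset.sum_congr rfl fun i _ => Finset.sum_congr rfl fun j _ => ?_
  rw [hs, map_smul, map_smul, h]

/-! ### Operator-sum representations, and positivity of tensor products. -/

section Kraus

set_option linter.unusedSectionVars false

variable {m n m' n' : Type} [Fintype m] [Fintype n] [Fintype m'] [Fintype n']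

/-- Maps with an operator-sum (Kraus) representation `X ↦ ∑ᵢ Kᵢ X Kᵢ†`. -/
def HasKraus (Φ : OpMap m n) : Prop :=
  ∃ (ι : Type) (_ : Fintype ι) (K : ι → Matrix n m ℂ),
    ∀ X, Φ X = ∑ i, K i * X * (K i).conjTranspose

theorem HasKraus.isPositiveMap {Φ : OpMap m n} (h : HasKraus Φ) : IsPositiveMap Φ := by
  obtain ⟨ι, _, K, hK⟩ := h
  intro X hX
  rw [hK]
  exact Matrix.posSemidef_sum _ fun i _ => hX.mul_mul_conjTranspose_same (K i)

theorem HasKraus.id [DecidableEq m] : HasKraus (LinearMap.id : OpMap m m) :=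
  ⟨Unit, inferInstance, fun _ => 1, fun X => by simp⟩

theorem HasKraus.add {Φ Ψ : OpMap m n} (hΦ : HasKraus Φ) (hΨ : HasKraus Ψ) :
    HasKraus (Φ + Ψ) := by
  obtain ⟨ι, _, K, hK⟩ := hΦ
  obtain ⟨κ, _, L, hL⟩ := hΨ
  exact ⟨ι ⊕ κ, inferInstance, Sum.elim K L, fun X => by simp [hK, hL]⟩

theorem HasKraus.smul {Φ : OpMap m n} (hΦ : HasKraus Φ) {c : ℝ} (hc : 0 ≤ c) :
    HasKraus ((c : ℂ) • Φ) := by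
  obtain ⟨ι, _, K, hK⟩ := hΦ
  refine ⟨ι, inferInstance, fun i => ((Real.sqrt c : ℝ) : ℂ) • K i, fun X => ?_⟩
  simp [hK, Finset.smul_sum, smul_smul, Real.mul_self_sqrt hc]

theorem HasKraus.tensorMap [DecidableEq m] [DecidableEq m'] {Φ : OpMap m n} {Ψ : OpMap m' n'}
    (hΦ : HasKraus Φ) (hΨ : HasKraus Ψ) : HasKraus (tensorMap Φ Ψ) := by
  obtain ⟨ι, _, K, hK⟩ := hΦ
  obtain ⟨κ, _, L, hL⟩ := hΨ
  refine ⟨ι × κ, inferInstance, fun i => K i.1 ⊗ₖ L i.2, fun X => ?_⟩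
  let F : OpMap (m × m') (n × n') :=
    { toFun := fun X => ∑ i : ι × κ, (K i.1 ⊗ₖ L i.2) * X * (K i.1 ⊗ₖ L i.2).conjTranspose
      map_add' := fun X Y => by simp [Matrix.mul_add, Matrix.add_mul, Finset.sum_add_distrib]
      map_smul' := fun c X => by simp [Finset.smul_sum] }
  have : _root_.tensorMap Φ Ψ = F := by
    refine linearMap_ext_kronecker fun A B => ?_
    rw [tensorMap_kronecker, hK, hL]
    change _ = ∑ i : ι × κ, (K i.1 ⊗ₖ L i.2) * (A ⊗ₖ B) * (K i.1 ⊗ₖ L i.2).conjTranspose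
    simp only [Matrix.conjTranspose_kronecker, ← Matrix.mul_kronecker_mul]
    rw [Fintype.sum_prod_type]
    ext a b
    simp [Matrix.sum_apply, Matrix.kroneckerMap_apply, Finset.sum_mul_sum]
  rw [this]
  rfl

theorem HasKraus.isCompletelyPositiveMap [DecidableEq m] {Φ : OpMap m n} (h : HasKraus Φ) :
    IsCompletelyPositiveMap Φ :=
  fun _ => (h.tensorMap HasKraus.id).isPositiveMap

theorem trace_tensorMap [DecidableEq m] [DecidableEq m'] {Φ : OpMap m n} {Ψ : OpMap m' n'}
    (hΦ : ∀ X, (Φ X).trace = X.trace) (hΨ : ∀ X, (Ψ X).trace = X.trace)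
    (X : Matrix (m × m') (m × m') ℂ) : (tensorMap Φ Ψ X).trace = X.trace := by
  have : Matrix.traceLinearMap (n × n') ℂ ℂ ∘ₗ tensorMap Φ Ψ
      = Matrix.traceLinearMap (m × m') ℂ ℂ := by
    refine linearMap_ext_kronecker fun A B => ?_
    simp [tensorMap_kronecker, Matrix.trace_kronecker, hΦ, hΨ]
  exact LinearMap.congr_fun this X

theorem HasKraus.isChannel_tensorMap [DecidableEq m] [DecidableEq m'] {Φ : OpMap m n}
    {Ψ : OpMap m' n'} (hΦ : HasKraus Φ) (hΨ : HasKraus Ψ)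
    (tΦ : ∀ X, (Φ X).trace = X.trace) (tΨ : ∀ X, (Ψ X).trace = X.trace) :
    IsChannel (_root_.tensorMap Φ Ψ) :=
  ⟨(hΦ.tensorMap hΨ).isCompletelyPositiveMap, trace_tensorMap tΦ tΨ⟩

/-- If `Φ ∘ T` and `Ψ ∘ T` have Kraus representations, where `T` is transposition, then `Φ ⊗ Ψ` is
positive. -/
theorem isPositiveMap_tensorMap_of_comp_transpose [DecidableEq m] [DecidableEq m']
    {Φ : OpMap m n} {Ψ : OpMap m' n'}
    (hΦ : HasKraus (Φ ∘ₗ (Matrix.transposeLinearEquiv m m ℂ ℂ).toLinearMap))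
    (hΨ : HasKraus (Ψ ∘ₗ (Matrix.transposeLinearEquiv m' m' ℂ ℂ).toLinearMap)) :
    IsPositiveMap (tensorMap Φ Ψ) := by
  intro X hX
  -- Global transposition preserves positive semidefiniteness, so it can absorb the two local
  -- transpositions.
  have h := (hΦ.tensorMap hΨ).isPositiveMap _ hX.transpose
  have e : tensorMap Φ Ψ = tensorMap (Φ ∘ₗ (Matrix.transposeLinearEquiv m m ℂ ℂ).toLinearMap)
      (Ψ ∘ₗ (Matrix.transposeLinearEquiv m' m' ℂ ℂ).toLinearMap) ∘ₗ
      (Matrix.transposeLinearEquiv (m × m') (m × m') ℂ ℂ).toLinearMap := by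
    refine linearMap_ext_kronecker fun A B => ?_
    have : (A ⊗ₖ B).transpose = A.transpose ⊗ₖ B.transpose :=
      (Matrix.kroneckerMap_transpose _ A B).symm
    simp [tensorMap_kronecker, this]
  rw [e]
  exact h

theorem IsPositiveMap.add {Φ Ψ : OpMap m n} (hΦ : IsPositiveMap Φ) (hΨ : IsPositiveMap Ψ) :
    IsPositiveMap (Φ + Ψ) := fun X hX => (hΦ X hX).add (hΨ X hX)

theorem IsPositiveMap.smul {Φ : OpMap m n} (hΦ : IsPositiveMap Φ) {c : ℝ} (hc : 0 ≤ c) :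
    IsPositiveMap ((c : ℂ) • Φ) := fun X hX => (hΦ X hX).smul (by exact_mod_cast hc)

end Kraus

/-! ### The unnormalized separable cone. -/

section Separable

set_option linter.unusedSectionVars false

variable {m n : Type} [Fintype m] [Fintype n]

/-- The cone spanned by the products of positive semidefinite operators. -/
def IsSeparableOperator (ω : Matrix (m × n) (m × n) ℂ) : Prop :=
  ∃ (ι : Type) (_ : Fintype ι) (R : ι → Matrix m m ℂ) (S : ι → Matrix n n ℂ),
    (∀ i, (R i).PosSemidef) ∧ (∀ i, (S i).PosSemidef) ∧ ω = ∑ i, R i ⊗ₖ S i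

theorem IsSeparableOperator.add {ω ω' : Matrix (m × n) (m × n) ℂ} (h : IsSeparableOperator ω)
    (h' : IsSeparableOperator ω') : IsSeparableOperator (ω + ω') := by
  obtain ⟨ι, _, R, S, hR, hS, rfl⟩ := h
  obtain ⟨κ, _, R', S', hR', hS', rfl⟩ := h'
  refine ⟨ι ⊕ κ, inferInstance, Sum.elim R R', Sum.elim S S', ?_, ?_, by simp⟩
  · rintro (i | i) <;> simp [hR, hR']
  · rintro (i | i) <;> simp [hS, hS']

theorem IsSeparableOperator.smul {ω : Matrix (m × n) (m × n) ℂ} (h : IsSeparableOperator ω) {c : ℝ}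
    (hc : 0 ≤ c) : IsSeparableOperator ((c : ℂ) • ω) := by
  obtain ⟨ι, _, R, S, hR, hS, rfl⟩ := h
  refine ⟨ι, inferInstance, fun i => (c : ℂ) • R i, S, fun i => (hR i).smul (by exact_mod_cast hc),
    hS, ?_⟩
  simp [Finset.smul_sum, Matrix.smul_kronecker]

theorem IsSeparableOperator.swap {ω : Matrix (m × n) (m × n) ℂ} (h : IsSeparableOperator ω) :
    IsSeparableOperator (ω.submatrix Prod.swap Prod.swap) := by
  obtain ⟨ι, _, R, S, hR, hS, rfl⟩ := h
  refine ⟨ι, inferInstance, S, R, hS, hR, ?_⟩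
  ext ⟨a, b⟩ ⟨c, e⟩
  simp [Matrix.sum_apply, mul_comm]

theorem IsSeparableState.isSeparableOperator {ω : Matrix (m × n) (m × n) ℂ}
    (h : IsSeparableState ω) :
    IsSeparableOperator ω := by
  obtain ⟨N, p, ρ, σ, hp, -, hρ, hσ, rfl⟩ := h
  refine ⟨Fin N, inferInstance, fun j => (p j : ℂ) • ρ j, σ,
    fun j => (hρ j).1.smul (by exact_mod_cast hp j), fun j => (hσ j).1, ?_⟩
  simp [Matrix.smul_kronecker]

theorem exists_density_smul {R : Matrix m m ℂ} (hR : R.PosSemidef) {δ : Matrix m m ℂ}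
    (hδ : IsDensity δ) :
    ∃ (r : ℝ) (ρ : Matrix m m ℂ), 0 ≤ r ∧ IsDensity ρ ∧ R = (r : ℂ) • ρ := by
  have h0 : 0 ≤ R.trace := hR.trace_nonneg
  have hr : ((R.trace.re : ℝ) : ℂ) = R.trace := by
    have := (Complex.nonneg_iff.1 h0).2
    apply Complex.ext <;> simp [← this]
  by_cases ht : R.trace = 0
  · refine ⟨0, δ, le_rfl, hδ, ?_⟩
    simpa using hR.trace_eq_zero_iff.1 ht
  · have hre : 0 ≤ R.trace.re := (Complex.nonneg_iff.1 h0).1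
    refine ⟨R.trace.re, ((R.trace.re⁻¹ : ℝ) : ℂ) • R, hre, ⟨hR.smul ?_, ?_⟩, ?_⟩
    · exact_mod_cast inv_nonneg.2 hre
    · rw [Matrix.trace_smul, smul_eq_mul, Complex.ofReal_inv, hr, inv_mul_cancel₀ ht]
    · rw [smul_smul, Complex.ofReal_inv, hr, mul_inv_cancel₀ ht, one_smul]

theorem exists_isDensity [Nonempty m] : ∃ δ : Matrix m m ℂ, IsDensity δ := by
  classical
  obtain ⟨a⟩ := ‹Nonempty m›
  refine ⟨Matrix.diagonal (Pi.single a 1), Matrix.PosSemidef.diagonal ?_, ?_⟩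
  · exact Pi.single_nonneg.2 zero_le_one
  · simp [Matrix.trace_diagonal]

/-- Normalization is deferred to this point: once each factor is a multiple of a density operator,
taking traces turns `ω.trace = 1` into the statement that the weights sum to one. -/
theorem IsSeparableOperator.isSeparableState {ω : Matrix (m × n) (m × n) ℂ}
    (h : IsSeparableOperator ω)
    (ht : ω.trace = 1) : IsSeparableState ω := by
  have hne : Nonempty (m × n) := by
    by_contra hc
    rw [not_nonempty_iff] at hc
    simp [Matrix.trace] at ht
  have : Nonempty m := hne.map Prod.fst
  have : Nonempty n := hne.map Prod.snd
  obtain ⟨δ, hδ⟩ := exists_isDensity (m := m)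
  obtain ⟨δ', hδ'⟩ := exists_isDensity (m := n)
  obtain ⟨ι, _, R, S, hR, hS, rfl⟩ := h
  choose r ρ hr hρ hRr using fun i => exists_density_smul (hR i) hδ
  choose s σ hs hσ hSs using fun i => exists_density_smul (hS i) hδ'
  let e := (Fintype.equivFin ι).symm
  have key : ∑ i, R i ⊗ₖ S i = ∑ j, ((r (e j) * s (e j) : ℝ) : ℂ) • (ρ (e j) ⊗ₖ σ (e j)) := by
    rw [← e.sum_comp]
    refine Finset.sum_congr rfl fun j _ => ?_
    rw [hRr, hSs, Matrix.smul_kronecker, Matrix.kronecker_smul, smul_smul, Complex.ofReal_mul]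
  refine ⟨_, fun j => r (e j) * s (e j), fun j => ρ (e j), fun j => σ (e j),
    fun j => mul_nonneg (hr _) (hs _), ?_, fun j => hρ _, fun j => hσ _, key⟩
  rw [key, Matrix.trace_sum] at ht
  simp only [Matrix.trace_smul, Matrix.trace_kronecker, (hρ _).2, (hσ _).2, mul_one,
    smul_eq_mul] at ht
  exact_mod_cast ht

end Separable

/-! ### Measure-and-prepare maps are entanglement-breaking. -/

section MeasurePrepare

variable {m n : Type} [Fintype m] [Fintype n]

/-- Measure-and-prepare form `X ↦ ∑ᵢ ⟨vᵢ|X|vᵢ⟩ Rᵢ` with positive semidefinite `Rᵢ`. -/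
def IsMeasurePrepare (Φ : OpMap m n) : Prop :=
  ∃ (ι : Type) (_ : Fintype ι) (v : ι → m → ℂ) (R : ι → Matrix n n ℂ),
    (∀ i, (R i).PosSemidef) ∧
      ∀ X, Φ X = ∑ i, (∑ a, ∑ b, star (v i a) * X a b * v i b) • R i

omit [Fintype n] in
theorem IsMeasurePrepare.add {Φ Ψ : OpMap m n} (hΦ : IsMeasurePrepare Φ)
    (hΨ : IsMeasurePrepare Ψ) : IsMeasurePrepare (Φ + Ψ) := by
  obtain ⟨ι, _, v, R, hR, hv⟩ := hΦ
  obtain ⟨κ, _, w, S, hS, hw⟩ := hΨ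
  refine ⟨ι ⊕ κ, inferInstance, Sum.elim v w, Sum.elim R S, ?_, fun X => by simp [hv, hw]⟩
  rintro (i | i) <;> simp [hR, hS]

omit [Fintype n] in
theorem IsMeasurePrepare.smul {Φ : OpMap m n} (hΦ : IsMeasurePrepare Φ) {c : ℝ} (hc : 0 ≤ c) :
    IsMeasurePrepare ((c : ℂ) • Φ) := by
  obtain ⟨ι, _, v, R, hR, hv⟩ := hΦ
  refine ⟨ι, inferInstance, v, fun i => (c : ℂ) • R i,
    fun i => (hR i).smul (by exact_mod_cast hc), fun X => ?_⟩
  rw [LinearMap.smul_apply, hv, Finset.smul_sum]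
  exact Finset.sum_congr rfl fun i _ => smul_comm _ _ _

/-- Splitting each `Rᵢ` into rank-one terms `|w⟩⟨w|` gives the Kraus operators `|w⟩⟨vᵢ|`. -/
theorem IsMeasurePrepare.hasKraus {Φ : OpMap m n} (hΦ : IsMeasurePrepare Φ) : HasKraus Φ := by
  obtain ⟨ι, _, v, R, hR, hv⟩ := hΦ
  choose N w hw using fun i => Matrix.posSemidef_iff_eq_sum_vecMulVec.1 (hR i)
  refine ⟨Σ i, Fin (N i), inferInstance,
    fun i => Matrix.vecMulVec (w i.1 i.2) (star (v i.1)), fun X => ?_⟩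
  rw [hv, Fintype.sum_sigma]
  refine Finset.sum_congr rfl fun i _ => ?_
  nth_rw 1 [hw]
  rw [Finset.smul_sum]
  refine Finset.sum_congr rfl fun k _ => ?_
  ext a b
  simp only [Matrix.smul_apply, Matrix.mul_apply, Matrix.conjTranspose_apply,
    Matrix.vecMulVec_apply, Pi.star_apply, smul_eq_mul, star_mul', star_star, Finset.sum_mul]
  rw [Finset.sum_comm]
  refine Finset.sum_congr rfl fun x _ => Finset.sum_congr rfl fun y _ => ?_
  ring

omit [Fintype n] in
theorem IsMeasurePrepare.isSeparableOperator_tensorMap {k : Type} [Fintype k] [DecidableEq k]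
    [DecidableEq m] {Φ : OpMap m n} (hΦ : IsMeasurePrepare Φ)
    {ω : Matrix (m × k) (m × k) ℂ} (hω : ω.PosSemidef) :
    IsSeparableOperator (tensorMap Φ (LinearMap.id : OpMap k k) ω) := by
  obtain ⟨ι, _, v, R, hR, hv⟩ := hΦ
  -- `Vᵢ = |vᵢ⟩ ⊗ I`, so `Vᵢ† ω Vᵢ` is the unnormalized state of the ancilla conditioned on outcome
  -- `i`.
  let V : ι → Matrix (m × k) k ℂ := fun i => Matrix.of fun a l => v i a.1 * (1 : Matrix k k ℂ) a.2 l
  let F : OpMap (m × k) (n × k) :=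
    { toFun := fun X => ∑ i, R i ⊗ₖ ((V i).conjTranspose * X * V i)
      map_add' := fun X Y => by
        simp [Matrix.mul_add, Matrix.add_mul, Matrix.kronecker_add, Finset.sum_add_distrib]
      map_smul' := fun c X => by simp [Finset.smul_sum, Matrix.kronecker_smul] }
  have hF : tensorMap Φ (LinearMap.id : OpMap k k) = F := by
    refine linearMap_ext_kronecker fun A B => ?_
    rw [tensorMap_kronecker, hv]
    change _ = ∑ i, R i ⊗ₖ ((V i).conjTranspose * (A ⊗ₖ B) * V i)
    have : ∀ i, (V i).conjTranspose * (A ⊗ₖ B) * V i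
        = (∑ a, ∑ b, star (v i a) * A a b * v i b) • B := by
      intro i
      ext x y
      simp only [Matrix.mul_apply, Matrix.conjTranspose_apply, V, Matrix.of_apply,
        Fintype.sum_prod_type, Matrix.kroneckerMap_apply, Matrix.smul_apply, smul_eq_mul,
        Matrix.one_apply, apply_ite star, star_zero, mul_ite, ite_mul,
        mul_one, mul_zero, zero_mul, Finset.sum_ite_eq', Finset.mem_univ, if_true]
      simp only [Finset.sum_mul]
      rw [Finset.sum_comm]
      refine Finset.sum_congr rfl fun a _ => Finset.sum_congr rfl fun b _ => ?_
      ring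
    simp only [this, Matrix.kronecker_smul]
    ext a b
    simp only [Matrix.sum_apply, Matrix.kroneckerMap_apply, Matrix.smul_apply, smul_eq_mul,
      LinearMap.id_apply, Finset.sum_mul]
    refine Finset.sum_congr rfl fun i _ => ?_
    simp only [mul_assoc]
  rw [hF]
  exact ⟨ι, inferInstance, R, fun i => (V i).conjTranspose * ω * V i, hR,
    fun i => hω.conjTranspose_mul_mul_same (V i), rfl⟩

theorem IsMeasurePrepare.isEntanglementBreaking [DecidableEq m] {Φ : OpMap m n}
    (hΦ : IsMeasurePrepare Φ) (ht : ∀ X, (Φ X).trace = X.trace) : IsEntanglementBreaking Φ := by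
  refine ⟨⟨hΦ.hasKraus.isCompletelyPositiveMap, ht⟩, fun k ω hω => ?_⟩
  refine (hΦ.isSeparableOperator_tensorMap hω.1).isSeparableState ?_
  rw [trace_tensorMap ht fun X => rfl, hω.2]

end MeasurePrepare

/-! ### Averages over vectors of fourth roots of unity. -/

section Phases

variable {d : ℕ}

/-- Vectors of fourth roots of unity. -/
abbrev PhaseVector (d : ℕ) : Type := Fin d → rootsOfUnity 4 ℂ

noncomputable instance : Fintype (rootsOfUnity 4 ℂ) := Fintype.ofFinite _

/-- The vector of complex numbers underlying a vector of phases. -/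
def PhaseVector.toVec (g : PhaseVector d) (a : Fin d) : ℂ := ((g a : ℂˣ) : ℂ)

/-- The imaginary unit as a fourth root of unity. -/
def rootI : rootsOfUnity 4 ℂ := rootsOfUnity.mkOfPowEq Complex.I Complex.I_pow_four

theorem rootI_coe : ((rootI : ℂˣ) : ℂ) = Complex.I := rfl

theorem star_root (z : rootsOfUnity 4 ℂ) :
    star ((z : ℂˣ) : ℂ) = (((z⁻¹ : rootsOfUnity 4 ℂ) : ℂˣ) : ℂ) := by
  have h : ‖((z : ℂˣ) : ℂ)‖ = 1 := by
    have : ((z : ℂˣ) : ℂ) ^ 4 = 1 := by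
      have := (mem_rootsOfUnity 4 (z : ℂˣ)).1 z.2
      rw [← Units.val_pow_eq_pow_val, this, Units.val_one]
    exact Complex.norm_eq_one_of_pow_eq_one this (by norm_num)
  have h2 : ((z : ℂˣ) : ℂ) * star ((z : ℂˣ) : ℂ) = 1 := by
    rw [Complex.star_def, Complex.mul_conj, Complex.normSq_eq_norm_sq, h]; norm_num
  rw [Subgroup.coe_inv, Units.val_inv_eq_inv_val]
  exact eq_inv_of_mul_eq_one_right h2

theorem PhaseVector.toVec_mul_star (g : PhaseVector d) (a : Fin d) :
    g.toVec a * star (g.toVec a) = 1 := by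
  rw [PhaseVector.toVec, star_root, Subgroup.coe_inv, Units.mul_inv]

/-- The character `g ↦ g_a⁻¹ g_b g_c g_e⁻¹` of the group of phase vectors. -/
def phaseChar (a b c e : Fin d) : PhaseVector d →* ℂ where
  toFun g := ((((g a)⁻¹ * g b * g c * (g e)⁻¹ : rootsOfUnity 4 ℂ) : ℂˣ) : ℂ)
  map_one' := by simp
  map_mul' g h := by
    simp only [Pi.mul_apply, mul_inv]
    push_cast
    ring

theorem phaseChar_apply (a b c e : Fin d) (g : PhaseVector d) :
    phaseChar a b c e g = star (g.toVec a) * g.toVec b * g.toVec c * star (g.toVec e) := by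
  simp [phaseChar, PhaseVector.toVec, star_root]

/-- A phase vector equal to `i` at one well-chosen coordinate and `1` elsewhere detects unpaired
indices. Square roots of unity would not do: for `a = e ≠ b, c` the value is `i⁻² = -1`, whereas
signs would give `1` and let a transpose term survive the average. -/
theorem phaseChar_ne_one {a b c e : Fin d} (h : ¬(a = b ∧ c = e ∨ a = c ∧ b = e)) :
    phaseChar a b c e ≠ 1 := by
  have hI : Complex.I ≠ 1 := fun h => by simpa using congrArg Complex.re h
  have hII : Complex.I⁻¹ * Complex.I⁻¹ ≠ 1 := by
    rw [← mul_inv, Complex.I_mul_I]; norm_num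
  have key : ∀ j, phaseChar a b c e (Pi.mulSingle j rootI)
      = (if a = j then Complex.I⁻¹ else 1) * (if b = j then Complex.I else 1)
        * (if c = j then Complex.I else 1) * (if e = j then Complex.I⁻¹ else 1) := by
    intro j
    simp only [phaseChar, Pi.mulSingle_apply, MonoidHom.coe_mk, OneHom.coe_mk]
    push_cast
    split_ifs <;> simp [rootI_coe]
  intro h1
  have key' : ∀ j, (if a = j then Complex.I⁻¹ else 1) * (if b = j then Complex.I else 1)
        * (if c = j then Complex.I else 1) * (if e = j then Complex.I⁻¹ else 1) = 1 := by
    intro j; rw [← key, h1, MonoidHom.one_apply]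
  by_cases hab : a = b
  · subst hab
    have hce : e ≠ c := fun h' => h (Or.inl ⟨rfl, h'.symm⟩)
    have := key' c
    by_cases hac : a = c <;> simp [hac, hce, hI] at this
  · by_cases hac : a = c
    · subst hac
      have hbe : e ≠ b := fun h' => h (Or.inr ⟨rfl, h'.symm⟩)
      have := key' b
      simp [hab, hbe, hI] at this
    · have := key' a
      have hn : -Complex.I ≠ 1 := fun h => by simpa using congrArg Complex.re h
      by_cases hae : e = a
      · simp only [Ne.symm hab, Ne.symm hac, hae, if_true, if_false, mul_one] at this
        exact hII this
      · simp [Ne.symm hab, Ne.symm hac, hae, hn] at this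

theorem sum_phaseChar (a b c e : Fin d) :
    ∑ g, phaseChar a b c e g
      = if a = b ∧ c = e ∨ a = c ∧ b = e then (Fintype.card (PhaseVector d) : ℂ) else 0 := by
  split_ifs with h
  · have : ∀ g : PhaseVector d, phaseChar a b c e g = 1 := by
      intro g
      rw [phaseChar_apply]
      have h1 := g.toVec_mul_star
      rcases h with ⟨rfl, rfl⟩ | ⟨rfl, rfl⟩
      · linear_combination (g.toVec c * star (g.toVec c)) * h1 a + h1 c
      · linear_combination (g.toVec b * star (g.toVec b)) * h1 a + h1 b
    simp [this]
  · exact sum_hom_units_eq_zero _ (phaseChar_ne_one h)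

/-- The projector `|ψ⟩⟨ψ|` (up to normalization) on a vector of phases. -/
def PhaseVector.proj (g : PhaseVector d) : Matrix (Fin d) (Fin d) ℂ :=
  Matrix.vecMulVec g.toVec (star g.toVec)

/-- Averaging measure-and-prepare maps over vectors of phases. -/
theorem sum_phase_measure (X : Matrix (Fin d) (Fin d) ℂ) :
    ∑ g : PhaseVector d, (∑ a, ∑ b, star (g.toVec a) * X a b * g.toVec b) • g.proj
      = (Fintype.card (PhaseVector d) : ℂ) •
        (X.trace • (1 : Matrix (Fin d) (Fin d) ℂ) + X - Matrix.diagonal X.diag) := by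
  ext c e
  have h1 : (∑ g : PhaseVector d, (∑ a, ∑ b, star (g.toVec a) * X a b * g.toVec b) • g.proj) c e
      = ∑ a, ∑ b, X a b * ∑ g, phaseChar a b c e g := by
    simp only [Matrix.sum_apply, Matrix.smul_apply, PhaseVector.proj, Matrix.vecMulVec_apply,
      Pi.star_apply, smul_eq_mul, Finset.sum_mul, phaseChar_apply, Finset.mul_sum]
    rw [Finset.sum_comm]
    refine Finset.sum_congr rfl fun a _ => ?_
    rw [Finset.sum_comm]
    refine Finset.sum_congr rfl fun b _ => Finset.sum_congr rfl fun g _ => ?_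
    ring
  rw [h1]
  simp only [sum_phaseChar]
  by_cases hce : c = e
  · subst hce
    have : ∀ a b : Fin d, (a = b ∨ a = c ∧ b = c) ↔ a = b :=
      fun a b => or_iff_left_of_imp fun h => h.1.trans h.2.symm
    simp [this, Matrix.trace, Finset.mul_sum, mul_comm]
  · simp [hce, ite_and, mul_comm]

theorem sum_phase_trace (X : Matrix (Fin d) (Fin d) ℂ) :
    ∑ g : PhaseVector d, (∑ a, ∑ b, star (g.toVec a) * X a b * g.toVec b)
      = (Fintype.card (PhaseVector d) : ℂ) * X.trace := by
  rcases Nat.eq_zero_or_pos d with rfl | hd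
  · simp [Matrix.trace]
  -- Every `g.proj` has unit diagonal, so any diagonal entry of the operator identity yields the
  -- scalar one.
  · have h := congrFun (congrFun (sum_phase_measure X) ⟨0, hd⟩) ⟨0, hd⟩
    simp only [Matrix.sum_apply, Matrix.smul_apply, PhaseVector.proj, Matrix.vecMulVec_apply,
      Pi.star_apply, smul_eq_mul, PhaseVector.toVec_mul_star, mul_one] at h
    simpa using h

theorem PhaseVector.posSemidef_proj (g : PhaseVector d) : g.proj.PosSemidef :=
  Matrix.posSemidef_vecMulVec_self_star _

theorem PhaseVector.posSemidef_compl (g : PhaseVector d) :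
    ((d : ℂ) • (1 : Matrix (Fin d) (Fin d) ℂ) - g.proj).PosSemidef := by
  rcases Nat.eq_zero_or_pos d with rfl | hd
  · convert Matrix.PosSemidef.zero using 1
    ext i; exact i.elim0
  have hd' : (d : ℂ) ≠ 0 := Nat.cast_ne_zero.2 hd.ne'
  set J := g.proj with hJ
  have hH : J.conjTranspose = J := g.posSemidef_proj.1
  -- `J/d` is a projection, hence `d·1 - J` is, up to scale, its complementary projection and equals
  -- `d⁻¹ (d·1 - J)†(d·1 - J)`.
  have hJJ : J * J = (d : ℂ) • J := by
    ext a b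
    have : ∀ x, g.toVec a * star (g.toVec x) * (g.toVec x * star (g.toVec b))
        = g.toVec a * star (g.toVec b) := fun x => by
      linear_combination g.toVec a * star (g.toVec b) * g.toVec_mul_star x
    simp only [hJ, PhaseVector.proj, Matrix.mul_apply, Matrix.vecMulVec_apply, Pi.star_apply,
      this, Matrix.smul_apply, smul_eq_mul]
    simp
  have hsq : ((d : ℂ) • (1 : Matrix (Fin d) (Fin d) ℂ) - J)
      = ((d : ℂ)⁻¹) • (((d : ℂ) • (1 : Matrix (Fin d) (Fin d) ℂ) - J).conjTranspose
        * ((d : ℂ) • (1 : Matrix (Fin d) (Fin d) ℂ) - J)) := by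
    rw [Matrix.conjTranspose_sub, hH, Matrix.conjTranspose_smul, Matrix.conjTranspose_one]
    have : star (d : ℂ) = d := by simp
    rw [this]
    simp only [sub_mul, mul_sub, Matrix.smul_mul, Matrix.mul_smul, one_mul, mul_one, hJJ]
    ext a b
    simp only [Matrix.smul_apply, Matrix.sub_apply, smul_eq_mul]
    field_simp
    ring
  rw [hsq]
  refine (Matrix.posSemidef_conjTranspose_mul_self _).smul ?_
  simp

end Phases

/-! ### Depolarizing maps: EB range, complete positivity, and positivity of `Φ_s ⊗ Φ_s`. -/

section Depolarizing

variable {d : ℕ}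

theorem depolarizing_apply (q : ℝ) (X : Matrix (Fin d) (Fin d) ℂ) :
    depolarizing d q X = (q : ℂ) • X + ((1 - q : ℂ) * (X.trace / d)) • 1 := by
  simp [depolarizing, traceMap, smul_smul]

theorem trace_traceMap (hd : d ≠ 0) (X : Matrix (Fin d) (Fin d) ℂ) :
    (traceMap d X).trace = X.trace := by
  have : (d : ℂ) ≠ 0 := Nat.cast_ne_zero.2 hd
  simp [traceMap, Matrix.trace_smul, this]

theorem trace_depolarizing (hd : d ≠ 0) (q : ℝ) (X : Matrix (Fin d) (Fin d) ℂ) :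
    (depolarizing d q X).trace = X.trace := by
  simp only [depolarizing, LinearMap.add_apply, LinearMap.smul_apply, LinearMap.id_apply,
    Matrix.trace_add, Matrix.trace_smul, trace_traceMap hd, smul_eq_mul]
  push_cast
  ring

theorem depolarizing_one : depolarizing d 1 = LinearMap.id := by
  simp [depolarizing]

/-- `Φ_q` depends affinely on `q`. -/
theorem depolarizing_convex (x y w : ℝ) :
    depolarizing d (w * x + (1 - w) * y)
      = (w : ℂ) • depolarizing d x + ((1 - w : ℝ) : ℂ) • depolarizing d y := by
  refine LinearMap.ext fun X => ?_
  ext a b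
  simp only [depolarizing_apply, LinearMap.add_apply, LinearMap.smul_apply, Matrix.add_apply,
    Matrix.smul_apply, smul_eq_mul]
  push_cast
  ring

theorem isMeasurePrepare_of_smul {m n : Type} [Fintype m] [Fintype n] {Φ : OpMap m n} {c : ℝ}
    (hc : 0 < c) (h : IsMeasurePrepare ((c : ℂ) • Φ)) : IsMeasurePrepare Φ := by
  have h' := h.smul (inv_nonneg.2 hc.le)
  rwa [smul_smul, ← Complex.ofReal_mul, inv_mul_cancel₀ hc.ne', Complex.ofReal_one, one_smul] at h'

theorem card_phaseVector_ne_zero : (Fintype.card (PhaseVector d) : ℂ) ≠ 0 :=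
  Nat.cast_ne_zero.2 Fintype.card_ne_zero

theorem card_phaseVector_inv_nonneg : (0 : ℂ) ≤ (Fintype.card (PhaseVector d) : ℂ)⁻¹ := by
  simp

theorem posSemidef_diagonal_single (i : Fin d) :
    (Matrix.diagonal (Pi.single i (1 : ℂ))).PosSemidef :=
  Matrix.PosSemidef.diagonal (Pi.single_nonneg.2 zero_le_one)

theorem posSemidef_one_sub_diagonal_single (i : Fin d) :
    (1 - Matrix.diagonal (Pi.single i (1 : ℂ))).PosSemidef := by
  rw [← Matrix.diagonal_one, Matrix.diagonal_sub]
  refine Matrix.PosSemidef.diagonal fun j => ?_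
  by_cases h : j = i
  · subst h; simp
  · simp [h]

theorem sum_star_single (X : Matrix (Fin d) (Fin d) ℂ) (i : Fin d) :
    ∑ a, ∑ b, star ((Pi.single i (1 : ℂ) : Fin d → ℂ) a) * X a b
      * (Pi.single i (1 : ℂ) : Fin d → ℂ) b = X i i := by
  simp [Pi.single_apply, apply_ite]

theorem sum_diag_smul (X : Matrix (Fin d) (Fin d) ℂ) :
    ∑ i, X i i • Matrix.diagonal (Pi.single i (1 : ℂ)) = Matrix.diagonal X.diag := by
  ext a b
  by_cases h : a = b
  · subst h
    simp [Matrix.sum_apply, Pi.single_apply]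
  · simp [Matrix.sum_apply, h]

/-- The map `X ↦ tr(X) I + X` is of measure-and-prepare form. -/
theorem isMeasurePrepare_trace_add {Φ : OpMap (Fin d) (Fin d)}
    (h : ∀ X, Φ X = X.trace • 1 + X) : IsMeasurePrepare Φ := by
  -- The phase average gives `tr(X) I + X` with the diagonal of `X` missing; measuring in the
  -- standard basis restores it.
  refine ⟨PhaseVector d ⊕ Fin d, inferInstance,
    Sum.elim PhaseVector.toVec fun i => Pi.single i 1,
    Sum.elim (fun g => (Fintype.card (PhaseVector d) : ℂ)⁻¹ • g.proj)
      fun i => Matrix.diagonal (Pi.single i 1), ?_, fun X => ?_⟩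
  · rintro (g | i)
    · exact g.posSemidef_proj.smul card_phaseVector_inv_nonneg
    · exact posSemidef_diagonal_single i
  · simp only [Fintype.sum_sum_type, Sum.elim_inl, Sum.elim_inr, sum_star_single, sum_diag_smul]
    simp only [smul_comm _ (Fintype.card (PhaseVector d) : ℂ)⁻¹]
    rw [← Finset.smul_sum, sum_phase_measure, smul_smul,
      inv_mul_cancel₀ card_phaseVector_ne_zero, one_smul, h]
    abel

/-- The map `X ↦ d tr(X) I - X` is of measure-and-prepare form. -/
theorem isMeasurePrepare_trace_sub {Φ : OpMap (Fin d) (Fin d)}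
    (h : ∀ X, Φ X = (d * X.trace) • 1 - X) : IsMeasurePrepare Φ := by
  -- The same measurements, with each prepared operator replaced by its complement.
  refine ⟨PhaseVector d ⊕ Fin d, inferInstance,
    Sum.elim PhaseVector.toVec fun i => Pi.single i 1,
    Sum.elim (fun g => (Fintype.card (PhaseVector d) : ℂ)⁻¹ • ((d : ℂ) • 1 - g.proj))
      fun i => 1 - Matrix.diagonal (Pi.single i 1), ?_, fun X => ?_⟩
  · rintro (g | i)
    · exact g.posSemidef_compl.smul card_phaseVector_inv_nonneg
    · exact posSemidef_one_sub_diagonal_single i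
  · simp only [Fintype.sum_sum_type, Sum.elim_inl, Sum.elim_inr, sum_star_single]
    simp only [smul_comm _ (Fintype.card (PhaseVector d) : ℂ)⁻¹]
    rw [← Finset.smul_sum]
    simp only [smul_sub, Finset.sum_sub_distrib, sum_phase_measure, sum_diag_smul,
      ← Finset.sum_smul, sum_phase_trace]
    have ht : ∑ i, X i i = X.trace := rfl
    have hN := card_phaseVector_ne_zero (d := d)
    rw [ht, h]
    ext a b
    simp only [Matrix.add_apply, Matrix.sub_apply, Matrix.smul_apply, smul_eq_mul]
    field_simp
    ring

theorem sq_sub_one_pos (hd : 2 ≤ d) : (0 : ℝ) < (d : ℝ) ^ 2 - 1 := by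
  have : (2 : ℝ) ≤ d := by exact_mod_cast hd
  nlinarith

theorem isMeasurePrepare_depolarizing_top (hd : 2 ≤ d) :
    IsMeasurePrepare (depolarizing d (1 / ((d : ℝ) + 1))) := by
  refine isMeasurePrepare_of_smul (c := (d : ℝ) + 1) (by positivity)
    (isMeasurePrepare_trace_add fun X => ?_)
  have h1 : (d : ℂ) ≠ 0 := Nat.cast_ne_zero.2 (by omega)
  have h2 : (d : ℂ) + 1 ≠ 0 := by exact_mod_cast Nat.succ_ne_zero d
  ext a b
  simp only [LinearMap.smul_apply, depolarizing_apply, Matrix.add_apply, Matrix.smul_apply,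
    smul_eq_mul]
  push_cast
  field_simp
  ring

theorem isMeasurePrepare_depolarizing_bot (hd : 2 ≤ d) :
    IsMeasurePrepare (depolarizing d (-1 / ((d : ℝ) ^ 2 - 1))) := by
  refine isMeasurePrepare_of_smul (c := (d : ℝ) ^ 2 - 1) (sq_sub_one_pos hd)
    (isMeasurePrepare_trace_sub fun X => ?_)
  have h1 : (d : ℂ) ≠ 0 := Nat.cast_ne_zero.2 (by omega)
  have h2 : (d : ℂ) ^ 2 - 1 ≠ 0 := by exact_mod_cast (sq_sub_one_pos hd).ne'
  ext a b
  simp only [LinearMap.smul_apply, depolarizing_apply, Matrix.add_apply, Matrix.sub_apply,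
    Matrix.smul_apply, smul_eq_mul]
  push_cast
  field_simp
  ring

/-- A point of a real segment as a convex combination of the end points. -/
theorem exists_convex_weight {x y z : ℝ} (h1 : x ≤ z) (h2 : z ≤ y) :
    ∃ w : ℝ, 0 ≤ w ∧ w ≤ 1 ∧ z = w * y + (1 - w) * x := by
  rcases eq_or_lt_of_le (h1.trans h2) with rfl | h
  · exact ⟨0, le_rfl, zero_le_one, by linarith⟩
  · have hp : 0 < y - x := sub_pos.2 h
    refine ⟨(z - x) / (y - x), div_nonneg (by linarith) hp.le, (div_le_one hp).2 (by linarith), ?_⟩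
    field_simp
    ring

theorem isEntanglementBreaking_depolarizing (hd : 2 ≤ d) {p : ℝ}
    (h1 : -1 / ((d : ℝ) ^ 2 - 1) ≤ p) (h2 : p ≤ 1 / ((d : ℝ) + 1)) :
    IsEntanglementBreaking (depolarizing d p) := by
  obtain ⟨w, hw0, hw1, rfl⟩ := exists_convex_weight h1 h2
  rw [depolarizing_convex]
  refine (((isMeasurePrepare_depolarizing_top hd).smul hw0).add
    ((isMeasurePrepare_depolarizing_bot hd).smul (sub_nonneg.2 hw1))).isEntanglementBreaking ?_
  rw [← depolarizing_convex]
  exact trace_depolarizing (by omega) _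

/-- `Φ_q` lies on the segment between the identity (`q = 1`) and the measure-and-prepare map at `q =
-1/(d²-1)`. -/
theorem hasKraus_depolarizing (hd : 2 ≤ d) {q : ℝ}
    (h1 : -1 / ((d : ℝ) ^ 2 - 1) ≤ q) (h2 : q ≤ 1) : HasKraus (depolarizing d q) := by
  obtain ⟨w, hw0, hw1, rfl⟩ := exists_convex_weight h1 h2
  rw [depolarizing_convex, depolarizing_one]
  exact (HasKraus.id.smul hw0).add
    ((isMeasurePrepare_depolarizing_bot hd).hasKraus.smul (sub_nonneg.2 hw1))

/-- The Kraus representation of `X ↦ tr(X) I - Xᵀ` by antisymmetric operators. -/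
theorem hasKraus_trace_sub_transpose {Φ : OpMap (Fin d) (Fin d)}
    (h : ∀ X, Φ X = (2 : ℂ) • (X.trace • 1 - X.transpose)) : HasKraus Φ := by
  refine ⟨Fin d × Fin d, inferInstance,
    -- Each unordered pair occurs twice, which is the factor `2` in the hypothesis.
    fun i => Matrix.single i.1 i.2 1 - Matrix.single i.2 i.1 1, fun X => ?_⟩
  rw [h, Fintype.sum_prod_type]
  simp only [Matrix.conjTranspose_sub, Matrix.conjTranspose_single, star_one, Matrix.sub_mul,
    Matrix.mul_sub, Matrix.single_mul_mul_single, one_mul, mul_one]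
  ext a b
  by_cases hab : a = b
  · subst hab
    simp only [Matrix.sum_apply, Matrix.sub_apply, Matrix.single_apply, Matrix.smul_apply,
      Matrix.one_apply, Matrix.transpose_apply, Finset.sum_sub_distrib, ite_and, smul_eq_mul]
    simp [Matrix.trace]
    ring
  · simp only [Matrix.sum_apply, Matrix.sub_apply, Matrix.single_apply, Matrix.smul_apply,
      Matrix.one_apply, Matrix.transpose_apply, Finset.sum_sub_distrib, ite_and, smul_eq_mul]
    simp [hab]
    ring

/-- After transposition, `s = 0` is unchanged and `s = -1/(d-1)` becomes a positive multiple of `X ↦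
tr(X) I - Xᵀ`; the rest is convexity. -/
theorem hasKraus_depolarizing_comp_transpose (hd : 2 ≤ d) {s : ℝ}
    (h1 : -1 / ((d : ℝ) - 1) ≤ s) (h2 : s ≤ 0) :
    HasKraus (depolarizing d s ∘ₗ (Matrix.transposeLinearEquiv (Fin d) (Fin d) ℂ ℂ).toLinearMap) := by
  obtain ⟨w, hw0, hw1, rfl⟩ := exists_convex_weight h1 h2
  have hd2 : (2 : ℝ) ≤ d := by exact_mod_cast hd
  rw [depolarizing_convex, LinearMap.add_comp, LinearMap.smul_comp, LinearMap.smul_comp]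
  have e0 : depolarizing d 0 ∘ₗ (Matrix.transposeLinearEquiv (Fin d) (Fin d) ℂ ℂ).toLinearMap
      = depolarizing d 0 := by
    refine LinearMap.ext fun X => ?_
    simp [depolarizing_apply]
  have hb : 0 ≤ (1 - w) * (1 / (2 * ((d : ℝ) - 1))) :=
    mul_nonneg (sub_nonneg.2 hw1) (div_nonneg zero_le_one (by linarith))
  have e1 : ((1 - w : ℝ) : ℂ) • (depolarizing d (-1 / ((d : ℝ) - 1)) ∘ₗ
      (Matrix.transposeLinearEquiv (Fin d) (Fin d) ℂ ℂ).toLinearMap)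
      = (((1 - w) * (1 / (2 * ((d : ℝ) - 1))) : ℝ) : ℂ) •
        ((2 * ((d : ℝ) - 1) : ℂ) • (depolarizing d (-1 / ((d : ℝ) - 1)) ∘ₗ
      (Matrix.transposeLinearEquiv (Fin d) (Fin d) ℂ ℂ).toLinearMap)) := by
    have : (d : ℂ) - 1 ≠ 0 := by
      have : (d : ℝ) - 1 ≠ 0 := by linarith
      exact_mod_cast this
    rw [smul_smul]
    congr 1
    push_cast
    field_simp
  rw [e0, e1]
  refine ((hasKraus_depolarizing hd ?_ zero_le_one).smul hw0).add
    ((hasKraus_trace_sub_transpose fun X => ?_).smul hb)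
  · exact div_nonpos_of_nonpos_of_nonneg (by norm_num) (sq_sub_one_pos hd).le
  · have h1 : (d : ℂ) ≠ 0 := Nat.cast_ne_zero.2 (by omega)
    have h2 : (d : ℂ) - 1 ≠ 0 := by
      have : (d : ℝ) - 1 ≠ 0 := by linarith
      exact_mod_cast this
    have hT : Matrix.transposeLinearEquiv (Fin d) (Fin d) ℂ ℂ X = X.transpose := rfl
    ext a b
    simp only [LinearMap.smul_apply, LinearMap.comp_apply, LinearEquiv.coe_coe, hT, depolarizing_apply,
      Matrix.trace_transpose,
      Matrix.add_apply, Matrix.sub_apply, Matrix.smul_apply, smul_eq_mul]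
    push_cast
    field_simp
    ring

/-- `Φ_s ⊗ Φ_s` is positive as soon as `Φ_s` is. -/
theorem isPositiveMap_depolarizing_tensor_self (hd : 2 ≤ d) {s : ℝ}
    (h1 : -1 / ((d : ℝ) - 1) ≤ s) (h2 : s ≤ 1) :
    IsPositiveMap (tensorMap (depolarizing d s) (depolarizing d s)) := by
  rcases le_total s 0 with hs | hs
  · have := hasKraus_depolarizing_comp_transpose hd h1 hs
    exact isPositiveMap_tensorMap_of_comp_transpose this this
  · have := hasKraus_depolarizing hd ((div_nonpos_of_nonpos_of_nonneg (by norm_num)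
      (sq_sub_one_pos hd).le).trans hs) h2
    exact (this.tensorMap this).isPositiveMap

end Depolarizing

/-! ### Positivity of `Λ_{st}`, the eigenvalue form of `(*)`, and separability of the output. -/

section Resolution

variable {d : ℕ}

theorem traceMap_traceMap (hd : d ≠ 0) (X : Matrix (Fin d) (Fin d) ℂ) :
    traceMap d (traceMap d X) = traceMap d X := by
  have h : traceMap d X = (X.trace / d) • (1 : Matrix (Fin d) (Fin d) ℂ) := rfl
  conv_lhs => rw [h, map_smul, traceMap_one d hd]
  exact h.symm

theorem depolarizing_eq (q : ℝ) (X : Matrix (Fin d) (Fin d) ℂ) :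
    depolarizing d q X = (q : ℂ) • X + ((1 - q : ℝ) : ℂ) • traceMap d X := rfl

/-- `Λ_{st}` depends affinely on `(s, t)`. -/
theorem lambdaMap_convex (s t s' t' w : ℝ) :
    lambdaMap d (w * s + (1 - w) * s') (w * t + (1 - w) * t')
      = (w : ℂ) • lambdaMap d s t + ((1 - w : ℝ) : ℂ) • lambdaMap d s' t' := by
  simp only [lambdaMap]
  push_cast
  module

/-- `Λ_{s,s²} = Φ_s ⊗ Φ_s`. -/
theorem lambdaMap_sq (s : ℝ) :
    lambdaMap d s (s ^ 2) = tensorMap (depolarizing d s) (depolarizing d s) := by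
  refine linearMap_ext_kronecker fun A B => ?_
  ext a b
  simp only [lambdaMap, LinearMap.add_apply, LinearMap.smul_apply, tensorMap_kronecker,
    LinearMap.sub_apply, LinearMap.id_apply, depolarizing_eq, Matrix.add_apply,
    Matrix.smul_apply, Matrix.sub_apply, Matrix.kroneckerMap_apply, smul_eq_mul]
  push_cast
  ring

theorem isPositiveMap_lambdaMap_convex {s t s' t' w : ℝ} (hw0 : 0 ≤ w) (hw1 : w ≤ 1)
    (h : IsPositiveMap (lambdaMap d s t)) (h' : IsPositiveMap (lambdaMap d s' t')) :
    IsPositiveMap (lambdaMap d (w * s + (1 - w) * s') (w * t + (1 - w) * t')) := by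
  rw [lambdaMap_convex]
  exact (h.smul hw0).add (h'.smul (sub_nonneg.2 hw1))

theorem isPositiveMap_lambdaMap_sq (hd : 2 ≤ d) {s : ℝ} (h1 : -1 / ((d : ℝ) - 1) ≤ s)
    (h2 : s ≤ 1) : IsPositiveMap (lambdaMap d s (s ^ 2)) := by
  rw [lambdaMap_sq]
  exact isPositiveMap_depolarizing_tensor_self hd h1 h2

/-- Positivity of `Λ_{st}` on the segment joining the identity and the universal inversion. -/
theorem isPositiveMap_lambdaMap_line (hd : 2 ≤ d) {s : ℝ} (h1 : -1 / ((d : ℝ) - 1) ≤ s)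
    (h2 : s ≤ 1) :
    IsPositiveMap (lambdaMap d s (1 / ((d : ℝ) - 1) + (1 - 1 / ((d : ℝ) - 1)) * s)) := by
  have hd2 : (2 : ℝ) ≤ d := by exact_mod_cast hd
  have hd1 : (d : ℝ) - 1 ≠ 0 := by linarith
  have hb : -1 / ((d : ℝ) - 1) ≤ 1 :=
    (div_nonpos_of_nonpos_of_nonneg (by norm_num) (by linarith)).trans zero_le_one
  obtain ⟨w, hw0, hw1, rfl⟩ := exists_convex_weight h1 h2
  -- The line is the chord of the parabola `t = s²` through `s = 1` and `s = -1/(d-1)`.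
  have := isPositiveMap_lambdaMap_convex hw0 hw1 (isPositiveMap_lambdaMap_sq hd hb le_rfl)
    (isPositiveMap_lambdaMap_sq hd le_rfl hb)
  convert this using 2
  field_simp
  ring

/-- Positivity of `Λ_{st}` between the parabola and the line. -/
theorem isPositiveMap_lambdaMap (hd : 2 ≤ d) {s t : ℝ} (h1 : -1 / ((d : ℝ) - 1) ≤ s)
    (h2 : s ≤ 1) (h3 : s ^ 2 ≤ t) (h4 : t ≤ 1 / ((d : ℝ) - 1) + (1 - 1 / ((d : ℝ) - 1)) * s) :
    IsPositiveMap (lambdaMap d s t) := by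
  obtain ⟨w, hw0, hw1, rfl⟩ := exists_convex_weight h3 h4
  have := isPositiveMap_lambdaMap_convex hw0 hw1 (isPositiveMap_lambdaMap_line hd h1 h2)
    (isPositiveMap_lambdaMap_sq hd h1 h2)
  convert this using 2
  ring

theorem trace_lambdaMap (hd : d ≠ 0) (s t : ℝ) (X : Matrix (Fin d × Fin d) (Fin d × Fin d) ℂ) :
    (lambdaMap d s t X).trace = X.trace := by
  have : Matrix.traceLinearMap (Fin d × Fin d) ℂ ℂ ∘ₗ lambdaMap d s t
      = Matrix.traceLinearMap (Fin d × Fin d) ℂ ℂ := by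
    refine linearMap_ext_kronecker fun A B => ?_
    simp [lambdaMap, tensorMap_kronecker, Matrix.trace_kronecker, trace_traceMap hd]
  exact LinearMap.congr_fun this X

/-- The equation `(*)` in terms of the parameters. -/
theorem tensorMap_depolarizing_eq (hd : d ≠ 0) {q₁ q₂ μ p s₁ t₁ s₂ t₂ : ℝ}
    (h1 : q₁ = μ * (p * s₁) + (1 - μ) * s₂) (h2 : q₂ = μ * s₁ + (1 - μ) * (p * s₂))
    (h3 : q₁ * q₂ = μ * (p * t₁) + (1 - μ) * (p * t₂)) :
    tensorMap (depolarizing d q₁) (depolarizing d q₂) =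
      (μ : ℂ) • (tensorMap (depolarizing d p) LinearMap.id ∘ₗ lambdaMap d s₁ t₁) +
      ((1 - μ : ℝ) : ℂ) • (tensorMap LinearMap.id (depolarizing d p) ∘ₗ lambdaMap d s₂ t₂) := by
  refine linearMap_ext_kronecker fun A B => ?_
  have h1' := congrArg (fun x : ℝ => (x : ℂ)) h1
  have h2' := congrArg (fun x : ℝ => (x : ℂ)) h2
  have h3' := congrArg (fun x : ℝ => (x : ℂ)) h3
  push_cast at h1' h2' h3'
  simp only [lambdaMap, LinearMap.add_apply, LinearMap.smul_apply, LinearMap.comp_apply,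
    tensorMap_kronecker, map_add, map_smul, LinearMap.sub_apply, LinearMap.id_apply,
    depolarizing_eq, map_sub, traceMap_traceMap hd]
  ext ⟨a, b⟩ ⟨a', b'⟩
  simp only [Matrix.add_apply, Matrix.smul_apply, Matrix.sub_apply, Matrix.kroneckerMap_apply,
    smul_eq_mul]
  push_cast
  -- Each eigenvalue equation is weighted by the component of `A ⊗ B` in its own sector.
  linear_combination ((A a a' - traceMap d A a a') * traceMap d B b b') * h1'
    + (traceMap d A a a' * (B b b' - traceMap d B b b')) * h2'
    + ((A a a' - traceMap d A a a') * (B b b' - traceMap d B b b')) * h3'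

theorem isDepolarizingResolution_of_eq (hd : 2 ≤ d) {q₁ q₂ μ p s₁ t₁ s₂ t₂ : ℝ}
    (hμ0 : 0 ≤ μ) (hμ1 : μ ≤ 1) (hp1 : -1 / ((d : ℝ) ^ 2 - 1) ≤ p)
    (hp2 : p ≤ 1 / ((d : ℝ) + 1)) (hΛ₁ : IsPositiveMap (lambdaMap d s₁ t₁))
    (hΛ₂ : IsPositiveMap (lambdaMap d s₂ t₂))
    (h1 : q₁ = μ * (p * s₁) + (1 - μ) * s₂) (h2 : q₂ = μ * s₁ + (1 - μ) * (p * s₂))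
    (h3 : q₁ * q₂ = μ * (p * t₁) + (1 - μ) * (p * t₂)) :
    IsDepolarizingResolution d q₁ q₂ μ p s₁ t₁ s₂ t₂ :=
  ⟨hμ0, hμ1, hp1, hp2, isEntanglementBreaking_depolarizing hd hp1 hp2, hΛ₁, hΛ₂,
    tensorMap_depolarizing_eq (by omega) h1 h2 h3⟩

theorem tensorMap_id_eq_swap (Φ : OpMap (Fin d) (Fin d))
    (X : Matrix (Fin d × Fin d) (Fin d × Fin d) ℂ) :
    tensorMap LinearMap.id Φ X
      = (tensorMap Φ LinearMap.id (X.submatrix Prod.swap Prod.swap)).submatrix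
          Prod.swap Prod.swap := by
  let σ : OpMap (Fin d × Fin d) (Fin d × Fin d) :=
    { toFun := fun X => X.submatrix Prod.swap Prod.swap
      map_add' := fun _ _ => rfl
      map_smul' := fun _ _ => rfl }
  have hσ : ∀ A B : Matrix (Fin d) (Fin d) ℂ, σ (A ⊗ₖ B) = B ⊗ₖ A := by
    intro A B
    ext ⟨a, b⟩ ⟨c, e⟩
    exact mul_comm _ _
  have : tensorMap LinearMap.id Φ = σ ∘ₗ tensorMap Φ LinearMap.id ∘ₗ σ := by
    refine linearMap_ext_kronecker fun A B => ?_
    simp only [LinearMap.comp_apply, hσ, tensorMap_kronecker, LinearMap.id_apply]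
  exact LinearMap.congr_fun this X

theorem IsDensity.swap {ω : Matrix (Fin d × Fin d) (Fin d × Fin d) ℂ} (h : IsDensity ω) :
    IsDensity (ω.submatrix Prod.swap Prod.swap) := by
  refine ⟨h.1.submatrix _, ?_⟩
  rw [← h.2]
  exact (Equiv.prodComm (Fin d) (Fin d)).sum_comp fun x => ω x x

/-- Positivity of `Λ_{st}` suffices, without complete positivity, since it acts on the whole input:
being trace preserving, it produces a state, and the EB property applies with the other subsystem as
environment. Exchanging the factors handles the second term. -/
theorem IsDepolarizingResolution.isEntanglementAnnihilating (hd : 2 ≤ d)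
    {q₁ q₂ μ p s₁ t₁ s₂ t₂ : ℝ} (h : IsDepolarizingResolution d q₁ q₂ μ p s₁ t₁ s₂ t₂)
    (h1 : -1 / ((d : ℝ) ^ 2 - 1) ≤ q₁) (h1' : q₁ ≤ 1)
    (h2 : -1 / ((d : ℝ) ^ 2 - 1) ≤ q₂) (h2' : q₂ ≤ 1) :
    IsEntanglementAnnihilating (tensorMap (depolarizing d q₁) (depolarizing d q₂)) := by
  have hd0 : d ≠ 0 := by omega
  obtain ⟨hμ0, hμ1, -, -, hEB, hΛ₁, hΛ₂, heq⟩ := h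
  have hch := (hasKraus_depolarizing hd h1 h1').isChannel_tensorMap
    (hasKraus_depolarizing hd h2 h2') (trace_depolarizing hd0 q₁) (trace_depolarizing hd0 q₂)
  refine ⟨hch, fun ρ hρ => IsSeparableOperator.isSeparableState ?_ ((hch.2 ρ).trans hρ.2)⟩
  rw [heq]
  have hd₁ : IsDensity (lambdaMap d s₁ t₁ ρ) :=
    ⟨hΛ₁ ρ hρ.1, (trace_lambdaMap hd0 _ _ ρ).trans hρ.2⟩
  have hd₂ : IsDensity (lambdaMap d s₂ t₂ ρ) :=
    ⟨hΛ₂ ρ hρ.1, (trace_lambdaMap hd0 _ _ ρ).trans hρ.2⟩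
  have e₁ := (hEB.2 d _ hd₁).isSeparableOperator
  have e₂ := (hEB.2 d _ hd₂.swap).isSeparableOperator.swap
  rw [← tensorMap_id_eq_swap] at e₂
  exact (e₁.smul hμ0).add (e₂.smul (sub_nonneg.2 hμ1))

end Resolution

/-! ### Solving the eigenvalue equations. -/

section Parameters

variable {d : ℕ}

/-- The parameters of a resolution of `Φ_{q₁} ⊗ Φ_{q₂}`, with `(*)` expressed by eigenvalues. -/
def HasResolutionParameters (d : ℕ) (q₁ q₂ : ℝ) : Prop :=
  ∃ μ p s₁ t₁ s₂ t₂ : ℝ, 0 ≤ μ ∧ μ ≤ 1 ∧ -1 / ((d : ℝ) ^ 2 - 1) ≤ p ∧ p ≤ 1 / ((d : ℝ) + 1) ∧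
    IsPositiveMap (lambdaMap d s₁ t₁) ∧ IsPositiveMap (lambdaMap d s₂ t₂) ∧
    q₁ = μ * (p * s₁) + (1 - μ) * s₂ ∧ q₂ = μ * s₁ + (1 - μ) * (p * s₂) ∧
    q₁ * q₂ = μ * (p * t₁) + (1 - μ) * (p * t₂)

theorem HasResolutionParameters.swap {q₁ q₂ : ℝ} (h : HasResolutionParameters d q₁ q₂) :
    HasResolutionParameters d q₂ q₁ := by
  obtain ⟨μ, p, s₁, t₁, s₂, t₂, hμ0, hμ1, hp1, hp2, hΛ₁, hΛ₂, h1, h2, h3⟩ := h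
  refine ⟨1 - μ, p, s₂, t₂, s₁, t₁, by linarith, by linarith, hp1, hp2, hΛ₂, hΛ₁, ?_, ?_, ?_⟩ <;>
    linarith

theorem HasResolutionParameters.exists_isDepolarizingResolution (hd : 2 ≤ d) {q₁ q₂ : ℝ}
    (h : HasResolutionParameters d q₁ q₂) :
    ∃ μ p s₁ t₁ s₂ t₂ : ℝ, IsDepolarizingResolution d q₁ q₂ μ p s₁ t₁ s₂ t₂ := by
  obtain ⟨μ, p, s₁, t₁, s₂, t₂, hμ0, hμ1, hp1, hp2, hΛ₁, hΛ₂, h1, h2, h3⟩ := h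
  exact ⟨μ, p, s₁, t₁, s₂, t₂,
    isDepolarizingResolution_of_eq hd hμ0 hμ1 hp1 hp2 hΛ₁ hΛ₂ h1 h2 h3⟩

theorem neg_inv_sub_one_le (hd : 2 ≤ d) : -1 / ((d : ℝ) - 1) ≤ -1 / ((d : ℝ) ^ 2 - 1) := by
  have hd2 : (2 : ℝ) ≤ d := by exact_mod_cast hd
  rw [neg_div, neg_div, neg_le_neg_iff]
  exact one_div_le_one_div_of_le (by linarith) (by nlinarith)

theorem inv_succ_le_one : 1 / ((d : ℝ) + 1) ≤ 1 := by
  have : (0 : ℝ) ≤ d := Nat.cast_nonneg d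
  rw [div_le_one (by linarith)]
  linarith

/-- `q₂` small: mix `Id ⊗ Φ_{q₂}` with `Φ_{q₂}² ⊗ Φ_{q₂}`. -/
theorem hasResolutionParameters_of_sq_le (hd : 2 ≤ d) {q₁ q₂ : ℝ}
    (h1 : -1 / ((d : ℝ) ^ 2 - 1) ≤ q₂) (h2 : q₂ ≤ 1 / ((d : ℝ) + 1)) (h3 : q₂ ^ 2 ≤ q₁)
    (h4 : q₁ ≤ 1) : HasResolutionParameters d q₁ q₂ := by
  obtain ⟨w, hw0, hw1, rfl⟩ := exists_convex_weight h3 h4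
  have hl := (neg_inv_sub_one_le hd).trans h1
  have hu := h2.trans inv_succ_le_one
  refine ⟨1 - w, q₂, q₂, q₂ ^ 2, 1, 1 ^ 2, by linarith, by linarith, h1, h2,
    isPositiveMap_lambdaMap_sq hd hl hu,
    isPositiveMap_lambdaMap_sq hd (hl.trans hu) le_rfl, ?_, ?_, ?_⟩ <;> ring

/-- `q₁ = p q₂`: the channel is `Φ_p ⊗ Id` after `Φ_{q₂} ⊗ Φ_{q₂}`. -/
theorem hasResolutionParameters_of_mul (hd : 2 ≤ d) {p q₂ : ℝ}
    (hp1 : -1 / ((d : ℝ) ^ 2 - 1) ≤ p) (hp2 : p ≤ 1 / ((d : ℝ) + 1))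
    (h1 : -1 / ((d : ℝ) ^ 2 - 1) ≤ q₂) (h2 : q₂ ≤ 1) :
    HasResolutionParameters d (p * q₂) q₂ := by
  have hl := (neg_inv_sub_one_le hd).trans h1
  have := isPositiveMap_lambdaMap_sq hd hl h2
  refine ⟨1, p, q₂, q₂ ^ 2, q₂, q₂ ^ 2, zero_le_one, le_rfl, hp1, hp2, this, this, ?_, ?_, ?_⟩ <;>
    ring

theorem neg_inv_le_inv_succ (hd : 2 ≤ d) : -1 / ((d : ℝ) ^ 2 - 1) ≤ 1 / ((d : ℝ) + 1) :=
  (div_nonpos_of_nonpos_of_nonneg (by norm_num) (sq_sub_one_pos hd).le).trans (by positivity)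

/-- `q₁, q₂` of the same sign and comparable: both positive maps are the same. -/
theorem hasResolutionParameters_of_cone (hd : 2 ≤ d) {q₁ q₂ μ : ℝ} (hμ0 : 0 ≤ μ) (hμ1 : μ ≤ 1)
    (hμ : ((d : ℝ) + 1) * q₂ - q₁ = μ * (d * (q₁ + q₂)))
    (h1 : -1 / ((d : ℝ) - 1) ≤ ((d : ℝ) + 1) / ((d : ℝ) + 2) * (q₁ + q₂))
    (h2 : ((d : ℝ) + 1) / ((d : ℝ) + 2) * (q₁ + q₂) ≤ 1)
    (h : ((d : ℝ) ^ 2 - 1) * q₁ * q₂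
        ≤ 1 + ((d : ℝ) - 2) * ((d : ℝ) + 1) / ((d : ℝ) + 2) * (q₁ + q₂)) :
    HasResolutionParameters d q₁ q₂ := by
  have hd2 : (2 : ℝ) ≤ d := by exact_mod_cast hd
  have hpos : (0 : ℝ) < (d : ℝ) - 1 := by linarith
  have hpos2 : (0 : ℝ) < (d : ℝ) + 2 := by linarith
  have hpos1 : (0 : ℝ) < (d : ℝ) + 1 := by linarith
  have hprod : 0 ≤ (((d : ℝ) + 1) * q₂ - q₁) * (((d : ℝ) + 1) * q₁ - q₂) := by
    have e : ((d : ℝ) + 1) * q₁ - q₂ = (1 - μ) * (d * (q₁ + q₂)) := by linarith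
    rw [hμ, e]
    have : 0 ≤ μ * (1 - μ) := mul_nonneg hμ0 (by linarith)
    nlinarith [mul_nonneg this (sq_nonneg ((d : ℝ) * (q₁ + q₂)))]
  -- The parabola condition `s² ≤ t` factors: it holds exactly when `(d+1)q₂ - q₁` and `(d+1)q₁ -
  -- q₂` have nonnegative product.
  have hlow : (((d : ℝ) + 1) / ((d : ℝ) + 2) * (q₁ + q₂)) ^ 2 ≤ ((d : ℝ) + 1) * (q₁ * q₂) := by
    have e : ((d : ℝ) + 1) * (q₁ * q₂) - (((d : ℝ) + 1) / ((d : ℝ) + 2) * (q₁ + q₂)) ^ 2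
        = ((d : ℝ) + 1) / ((d : ℝ) + 2) ^ 2
          * ((((d : ℝ) + 1) * q₂ - q₁) * (((d : ℝ) + 1) * q₁ - q₂)) := by
      field_simp
      ring
    have : 0 ≤ ((d : ℝ) + 1) / ((d : ℝ) + 2) ^ 2
          * ((((d : ℝ) + 1) * q₂ - q₁) * (((d : ℝ) + 1) * q₁ - q₂)) := by positivity
    linarith
  have hup : ((d : ℝ) + 1) * (q₁ * q₂) ≤ 1 / ((d : ℝ) - 1)
      + (1 - 1 / ((d : ℝ) - 1)) * (((d : ℝ) + 1) / ((d : ℝ) + 2) * (q₁ + q₂)) := by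
    have e : 1 / ((d : ℝ) - 1)
        + (1 - 1 / ((d : ℝ) - 1)) * (((d : ℝ) + 1) / ((d : ℝ) + 2) * (q₁ + q₂))
        = (1 + ((d : ℝ) - 2) * ((d : ℝ) + 1) / ((d : ℝ) + 2) * (q₁ + q₂)) / ((d : ℝ) - 1) := by
      field_simp
      ring
    rw [e, le_div_iff₀ hpos]
    linarith
  have hΛ := isPositiveMap_lambdaMap hd h1 h2 hlow hup
  refine ⟨μ, 1 / ((d : ℝ) + 1), _, _, _, _, hμ0, hμ1, neg_inv_le_inv_succ hd, le_rfl, hΛ, hΛ,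
    ?_, ?_, ?_⟩
  · field_simp
    linear_combination -hμ
  · field_simp
    linear_combination hμ
  · field_simp
    ring

/-- `(1-q₁)(1-q₂) ≥ 0` bounds `q₁q₂` below by `q₁+q₂-1`; inserted in the curve inequality this
leaves a linear condition on the sum, namely `s ≤ 1` for the common parameter `s`. -/
theorem sum_le_of_le_curve (hd : 2 ≤ d) {q₁ q₂ : ℝ} (h1 : q₁ ≤ 1) (h2 : q₂ ≤ 1)
    (h : ((d : ℝ) ^ 2 - 1) * q₁ * q₂
        ≤ 1 + ((d : ℝ) - 2) * ((d : ℝ) + 1) / ((d : ℝ) + 2) * (q₁ + q₂)) :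
    ((d : ℝ) + 1) / ((d : ℝ) + 2) * (q₁ + q₂) ≤ 1 := by
  have hd2 : (2 : ℝ) ≤ d := by exact_mod_cast hd
  have hxy : q₁ + q₂ - 1 ≤ q₁ * q₂ := by
    nlinarith [mul_nonneg (sub_nonneg.2 h1) (sub_nonneg.2 h2)]
  have hm := mul_le_mul_of_nonneg_left hxy (sq_sub_one_pos hd).le
  have e : ((d : ℝ) ^ 2 - 1) * (q₁ + q₂ - 1)
      - (1 + ((d : ℝ) - 2) * ((d : ℝ) + 1) / ((d : ℝ) + 2) * (q₁ + q₂))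
      = (d : ℝ) ^ 2 * (((d : ℝ) + 1) / ((d : ℝ) + 2) * (q₁ + q₂) - 1) := by
    field_simp
    ring
  have : (d : ℝ) ^ 2 * (((d : ℝ) + 1) / ((d : ℝ) + 2) * (q₁ + q₂) - 1) ≤ 0 := by
    rw [← e]; linarith
  have := nonpos_of_mul_nonpos_right this (by positivity)
  linarith

/-- The curve inequality matters only when both `qᵢ` exceed `1/(d+1)`. Otherwise a small `qᵢ` with
`qᵢ² ≤ qⱼ` can itself serve as `p`; failing that, some `qᵢ` is negative, and either the ratio of the
two is an admissible `p` or both are negative and comparable, so that the common-`Λ` solution works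
again. -/
theorem hasResolutionParameters (hd : 2 ≤ d) {q₁ q₂ : ℝ}
    (h1 : -1 / ((d : ℝ) ^ 2 - 1) ≤ q₁) (h1' : q₁ ≤ 1)
    (h2 : -1 / ((d : ℝ) ^ 2 - 1) ≤ q₂) (h2' : q₂ ≤ 1)
    (h : ((d : ℝ) ^ 2 - 1) * q₁ * q₂
        ≤ 1 + ((d : ℝ) - 2) * ((d : ℝ) + 1) / ((d : ℝ) + 2) * (q₁ + q₂)) :
    HasResolutionParameters d q₁ q₂ := by
  have hd2 : (2 : ℝ) ≤ d := by exact_mod_cast hd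
  have hpos : (0 : ℝ) < (d : ℝ) - 1 := by linarith
  have hpos0 : (0 : ℝ) < d := by linarith
  have hpos2 : (0 : ℝ) < (d : ℝ) + 2 := by linarith
  have hpos1 : (0 : ℝ) < (d : ℝ) + 1 := by linarith
  have hsq := sq_sub_one_pos hd
  have hp0 : (0 : ℝ) ≤ 1 / ((d : ℝ) + 1) := by positivity
  have hp1 := inv_succ_le_one (d := d)
  have hε : -(1 / ((d : ℝ) + 1)) ≤ -1 / ((d : ℝ) ^ 2 - 1) := by
    rw [neg_div, neg_le_neg_iff]
    exact one_div_le_one_div_of_le hpos1 (by nlinarith)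
  by_cases c1 : q₂ ≤ 1 / ((d : ℝ) + 1) ∧ q₂ ^ 2 ≤ q₁
  · exact hasResolutionParameters_of_sq_le hd h2 c1.1 c1.2 h1'
  by_cases c2 : q₁ ≤ 1 / ((d : ℝ) + 1) ∧ q₁ ^ 2 ≤ q₂
  · exact (hasResolutionParameters_of_sq_le hd h1 c2.1 c2.2 h2').swap
  by_cases c3 : 1 / ((d : ℝ) + 1) < q₁ ∧ 1 / ((d : ℝ) + 1) < q₂
  · obtain ⟨c3, c3'⟩ := c3
    have g1 : 1 < q₁ * ((d : ℝ) + 1) := (div_lt_iff₀ hpos1).1 c3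
    have g2 : 1 < q₂ * ((d : ℝ) + 1) := (div_lt_iff₀ hpos1).1 c3'
    have hS : 0 < (d : ℝ) * (q₁ + q₂) := mul_pos hpos0 (by linarith)
    have hS1 := sum_le_of_le_curve hd h1' h2' h
    refine hasResolutionParameters_of_cone hd
      (μ := (((d : ℝ) + 1) * q₂ - q₁) / (d * (q₁ + q₂)))
      (div_nonneg (by linarith) hS.le) ((div_le_one hS).2 (by linarith))
      (div_mul_cancel₀ _ hS.ne').symm ?_ hS1 h
    have : 0 ≤ ((d : ℝ) + 1) / ((d : ℝ) + 2) * (q₁ + q₂) := by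
      have : 0 ≤ q₁ + q₂ := by linarith
      positivity
    exact (div_nonpos_of_nonpos_of_nonneg (by norm_num) hpos.le).trans this
  -- Here `|x| ≤ 1/(d+1) ≤ 1`, so anything below `x²` is small too: both exclusions then yield
  -- strict inequalities.
  have hsmall : ∀ x y : ℝ, -1 / ((d : ℝ) ^ 2 - 1) ≤ x → x ≤ 1 / ((d : ℝ) + 1) → y < x ^ 2 →
      y ≤ 1 / ((d : ℝ) + 1) := by
    intro x y hx1 hx2 hy
    have : x ^ 2 ≤ (1 / ((d : ℝ) + 1)) ^ 2 := sq_le_sq' (hε.trans hx1) hx2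
    nlinarith
  have c4 : q₁ < q₂ ^ 2 ∧ q₂ < q₁ ^ 2 := by
    by_cases c : q₂ ≤ 1 / ((d : ℝ) + 1)
    · have g : q₁ < q₂ ^ 2 := lt_of_not_ge fun g => c1 ⟨c, g⟩
      exact ⟨g, lt_of_not_ge fun g' => c2 ⟨hsmall _ _ h2 c g, g'⟩⟩
    · have c' : q₁ ≤ 1 / ((d : ℝ) + 1) := le_of_not_gt fun g => c3 ⟨g, not_le.1 c⟩
      have g : q₂ < q₁ ^ 2 := lt_of_not_ge fun g => c2 ⟨c', g⟩
      exact absurd (hsmall _ _ h1 c' g) c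
  have hratio : ∀ x y : ℝ, -1 / ((d : ℝ) ^ 2 - 1) ≤ x → x < 0 → y ≤ 1 → y < x ^ 2 →
      ((d : ℝ) + 1) * y - x ≥ 0 → HasResolutionParameters d y x := by
    intro x y hx1 hx2 hy1 hy hyx
    have e : y = (y / x) * x := (div_mul_cancel₀ _ hx2.ne).symm
    rw [e]
    refine hasResolutionParameters_of_mul hd ?_ ?_ hx1 (by linarith)
    · refine hx1.trans ?_
      rw [le_div_iff_of_neg hx2]
      nlinarith
    · rw [div_le_iff_of_neg hx2]
      field_simp
      linarith
  obtain ⟨c4, c5⟩ := c4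
  -- For nonnegative values at most `1`, `q₁ < q₂² ≤ q₂ < q₁² ≤ q₁` would be a contradiction.
  have hneg : q₁ < 0 ∨ q₂ < 0 := by
    by_contra! hc
    nlinarith
  by_cases c6 : q₁ < 0 ∧ 0 ≤ ((d : ℝ) + 1) * q₂ - q₁
  · exact (hratio q₁ q₂ h1 c6.1 h2' c5 c6.2).swap
  by_cases c7 : q₂ < 0 ∧ 0 ≤ ((d : ℝ) + 1) * q₁ - q₂
  · exact hratio q₂ q₁ h2 c7.1 h1' c4 c7.2
  have hn1 : q₁ < 0 := by
    by_contra! hc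
    have g : q₂ < 0 := hneg.resolve_left (not_lt.2 hc)
    exact c7 ⟨g, by nlinarith⟩
  have hn2 : q₂ < 0 := by
    by_contra! hc
    exact c6 ⟨hn1, by nlinarith⟩
  have g1 : ((d : ℝ) + 1) * q₂ - q₁ ≤ 0 := le_of_not_ge fun g => c6 ⟨hn1, g⟩
  have g2 : ((d : ℝ) + 1) * q₁ - q₂ ≤ 0 := le_of_not_ge fun g => c7 ⟨hn2, g⟩
  have hS : (d : ℝ) * (q₁ + q₂) < 0 := mul_neg_of_pos_of_neg hpos0 (by linarith)
  refine hasResolutionParameters_of_cone hd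
      (μ := (((d : ℝ) + 1) * q₂ - q₁) / (d * (q₁ + q₂)))
      (div_nonneg_of_nonpos g1 hS.le) ((div_le_one_of_neg hS).2 (by linarith))
      (div_mul_cancel₀ _ hS.ne).symm ?_ ?_ h
  · have e : -1 / ((d : ℝ) - 1) = ((d : ℝ) + 1) / ((d : ℝ) + 2)
        * (((d : ℝ) + 2) * (-1 / ((d : ℝ) ^ 2 - 1))) := by
      have : (d : ℝ) ^ 2 - 1 = ((d : ℝ) - 1) * ((d : ℝ) + 1) := by ring
      rw [this]
      field_simp
    rw [e]
    refine mul_le_mul_of_nonneg_left ?_ (by positivity)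
    have : -1 / ((d : ℝ) ^ 2 - 1) < 0 := div_neg_of_neg_of_pos (by norm_num) hsq
    nlinarith
  · have : ((d : ℝ) + 1) / ((d : ℝ) + 2) * (q₁ + q₂) ≤ 0 :=
      mul_nonpos_of_nonneg_of_nonpos (by positivity) (by linarith)
    linarith

/-- The bounds on `s₁` in the explicit resolution. -/
theorem explicit_param_bounds (hd : 2 ≤ d) {x y : ℝ} (hx1 : x < 1)
    (hy : 1 / ((d : ℝ) + 1) < y) (hS : ((d : ℝ) + 1) * (x + y) ≤ d + 2) :
    0 < (d : ℝ) + ((d : ℝ) + 1) * (y - x) ∧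
    0 ≤ 2 * ((d : ℝ) + 1) / ((d : ℝ) + 2) *
      ((((d : ℝ) + 1) * y - x) / ((d : ℝ) + ((d : ℝ) + 1) * (y - x))) ∧
    2 * ((d : ℝ) + 1) / ((d : ℝ) + 2) *
      ((((d : ℝ) + 1) * y - x) / ((d : ℝ) + ((d : ℝ) + 1) * (y - x))) ≤ 1 := by
  have hd2 : (2 : ℝ) ≤ d := by exact_mod_cast hd
  have hpos1 : (0 : ℝ) < (d : ℝ) + 1 := by linarith
  have hpos2 : (0 : ℝ) < (d : ℝ) + 2 := by linarith
  have g2 : 1 < y * ((d : ℝ) + 1) := (div_lt_iff₀ hpos1).1 hy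
  have hden : 0 < (d : ℝ) + ((d : ℝ) + 1) * (y - x) := by nlinarith
  refine ⟨hden, mul_nonneg (by positivity) (div_nonneg (by linarith) hden.le), ?_⟩
  rw [div_mul_div_comm, div_le_one (by positivity)]
  -- With denominators cleared, the two sides differ by `d(d+2-(d+1)(x+y))`, so this is exactly
  -- `hS`.
  nlinarith

/-- With `N = d²-1` and `k = (d-2)(d+1)/(d+2)`, the curve reads `y(Nx-k) = 1+kx`. On the branch `Nx
> k`, `y < 1` gives `(N-k)x > 1+k`, and `N-k = (d+1)(1+k)`. On the branch `Nx < k`, the lower bounds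
on `x` and `y` force `N ≤ 2k+1`, which is false. -/
theorem inv_succ_lt_of_curve (hd : 2 ≤ d) {x y : ℝ}
    (h1 : -1 / ((d : ℝ) ^ 2 - 1) ≤ x) (hx1 : x < 1) (h2 : -1 / ((d : ℝ) ^ 2 - 1) ≤ y) (hy1 : y < 1)
    (h : ((d : ℝ) ^ 2 - 1) * x * y
        = 1 + ((d : ℝ) - 2) * ((d : ℝ) + 1) / ((d : ℝ) + 2) * (x + y)) :
    1 / ((d : ℝ) + 1) < x := by
  have hd2 : (2 : ℝ) ≤ d := by exact_mod_cast hd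
  have hN := sq_sub_one_pos hd
  have hpos2 : (0 : ℝ) < (d : ℝ) + 2 := by linarith
  have e1 : (d : ℝ) ^ 2 - 1 - ((d : ℝ) - 2) * ((d : ℝ) + 1) / ((d : ℝ) + 2)
      = ((d : ℝ) + 1) * (1 + ((d : ℝ) - 2) * ((d : ℝ) + 1) / ((d : ℝ) + 2)) := by
    field_simp
    ring
  have e2 : 2 * (((d : ℝ) - 2) * ((d : ℝ) + 1) / ((d : ℝ) + 2)) + 1 < (d : ℝ) ^ 2 - 1 := by
    have : (d : ℝ) ^ 2 - 1 - (2 * (((d : ℝ) - 2) * ((d : ℝ) + 1) / ((d : ℝ) + 2)) + 1)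
        = (d : ℝ) ^ 3 / ((d : ℝ) + 2) := by
      field_simp
      ring
    have h3 : 0 < (d : ℝ) ^ 3 / ((d : ℝ) + 2) := by positivity
    linarith
  have hk : 0 ≤ ((d : ℝ) - 2) * ((d : ℝ) + 1) / ((d : ℝ) + 2) :=
    div_nonneg (mul_nonneg (by linarith) (by linarith)) hpos2.le
  generalize ((d : ℝ) - 2) * ((d : ℝ) + 1) / ((d : ℝ) + 2) = k at *
  rw [div_le_iff₀ hN] at h1 h2
  generalize (d : ℝ) ^ 2 - 1 = N at *
  have hx : 0 < 1 + k * x := by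
    by_contra! hc
    nlinarith
  have hy : y * (N * x - k) = 1 + k * x := by linarith
  rw [div_lt_iff₀ (by linarith)]
  rcases lt_or_ge (N * x - k) 0 with hs | hs
  · have h3 : N * (1 + k * x) ≤ k - N * x := by
      rw [← hy]
      nlinarith
    nlinarith
  · have h4 : 1 + k * x < N * x - k := by
      rcases hs.eq_or_lt with hs | hs
      · rw [← hs] at hy; linarith
      · nlinarith
    have h5 : 1 + k < x * (((d : ℝ) + 1) * (1 + k)) := by rw [← e1]; linarith
    nlinarith

end Parameters

/-! ### The boundary curve, the symmetric threshold, and the theorem. -/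

section Main

variable {d : ℕ}

/-- The explicit resolution on the boundary curve. -/
theorem isDepolarizingResolution_curve (hd : 2 ≤ d) {q₁ q₂ s₁ s₂ : ℝ}
    (h1 : -1 / ((d : ℝ) ^ 2 - 1) ≤ q₁) (h1' : q₁ < 1)
    (h2 : -1 / ((d : ℝ) ^ 2 - 1) ≤ q₂) (h2' : q₂ < 1)
    (h : ((d : ℝ) ^ 2 - 1) * q₁ * q₂
        = 1 + ((d : ℝ) - 2) * ((d : ℝ) + 1) / ((d : ℝ) + 2) * (q₁ + q₂))
    (hs₁ : s₁ = 2 * ((d : ℝ) + 1) / ((d : ℝ) + 2) *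
        ((((d : ℝ) + 1) * q₂ - q₁) / ((d : ℝ) + ((d : ℝ) + 1) * (q₂ - q₁))))
    (hs₂ : s₂ = 2 * ((d : ℝ) + 1) / ((d : ℝ) + 2) *
        ((((d : ℝ) + 1) * q₁ - q₂) / ((d : ℝ) + ((d : ℝ) + 1) * (q₁ - q₂)))) :
    IsDepolarizingResolution d q₁ q₂
        (1 / 2 + ((d : ℝ) + 1) / (2 * (d : ℝ)) * (q₂ - q₁))
        (1 / ((d : ℝ) + 1))
        s₁ (1 / ((d : ℝ) - 1) + (1 - 1 / ((d : ℝ) - 1)) * s₁)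
        s₂ (1 / ((d : ℝ) - 1) + (1 - 1 / ((d : ℝ) - 1)) * s₂) := by
  have hd2 : (2 : ℝ) ≤ d := by exact_mod_cast hd
  have hpos : (0 : ℝ) < d := by linarith
  have hpos1 : (0 : ℝ) < (d : ℝ) - 1 := by linarith
  have hb : -1 / ((d : ℝ) - 1) ≤ 0 := div_nonpos_of_nonpos_of_nonneg (by norm_num) hpos1.le
  have hq₁ := inv_succ_lt_of_curve hd h1 h1' h2 h2' h
  have hq₂ := inv_succ_lt_of_curve hd h2 h2' h1 h1' (by linarith)
  have hS : ((d : ℝ) + 1) * (q₁ + q₂) ≤ d + 2 := by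
    have := sum_le_of_le_curve hd h1'.le h2'.le h.le
    rw [div_mul_eq_mul_div, div_le_one (by linarith)] at this
    exact this
  obtain ⟨hD₁, hl₁, hu₁⟩ := explicit_param_bounds hd h1' hq₂ hS
  obtain ⟨hD₂, hl₂, hu₂⟩ := explicit_param_bounds hd h2' hq₁ (by linarith)
  rw [← hs₁] at hl₁ hu₁
  rw [← hs₂] at hl₂ hu₂
  set μ := 1 / 2 + ((d : ℝ) + 1) / (2 * (d : ℝ)) * (q₂ - q₁) with hμ
  have hμ₁ : μ = ((d : ℝ) + ((d : ℝ) + 1) * (q₂ - q₁)) / (2 * d) := by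
    rw [hμ]; field_simp
  have hμ₂ : 1 - μ = ((d : ℝ) + ((d : ℝ) + 1) * (q₁ - q₂)) / (2 * d) := by
    rw [hμ]; field_simp; ring
  -- The denominator of `s₁` is `2dμ`, so only the products `μ s₁` and `(1-μ) s₂`, linear in `q₁,
  -- q₂`, enter the equations.
  have a₁ : μ * s₁ = ((d : ℝ) + 1) / (d * ((d : ℝ) + 2)) * (((d : ℝ) + 1) * q₂ - q₁) := by
    rw [hμ₁, hs₁]; field_simp
  have a₂ : (1 - μ) * s₂ = ((d : ℝ) + 1) / (d * ((d : ℝ) + 2)) * (((d : ℝ) + 1) * q₁ - q₂) := by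
    rw [hμ₂, hs₂]; field_simp
  refine isDepolarizingResolution_of_eq hd ?_ ?_ (neg_inv_le_inv_succ hd) le_rfl
    (isPositiveMap_lambdaMap_line hd (hb.trans hl₁) hu₁)
    (isPositiveMap_lambdaMap_line hd (hb.trans hl₂) hu₂) ?_ ?_ ?_
  · rw [hμ₁]; positivity
  · have : 0 ≤ 1 - μ := by rw [hμ₂]; positivity
    linarith
  · have e : q₁ = 1 / ((d : ℝ) + 1) * (μ * s₁) + (1 - μ) * s₂ := by
      rw [a₁, a₂]; field_simp; ring
    linarith
  · have e : q₂ = μ * s₁ + 1 / ((d : ℝ) + 1) * ((1 - μ) * s₂) := by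
      rw [a₁, a₂]; field_simp; ring
    linarith
  -- Because `tᵢ` is affine in `sᵢ`, the third equation depends only on `μ s₁ + (1-μ) s₂` and
  -- becomes the equation of the curve.
  · have e : q₁ * q₂ = 1 / ((d : ℝ) + 1) * (1 / ((d : ℝ) - 1)
        + (1 - 1 / ((d : ℝ) - 1)) * (μ * s₁ + (1 - μ) * s₂)) := by
      rw [a₁, a₂]
      field_simp
      field_simp at h
      linear_combination (d : ℝ) * h
    linarith

theorem le_curve_of_le_sqrt (hd : 2 ≤ d) {q : ℝ} (h1 : -1 / ((d : ℝ) ^ 2 - 1) ≤ q)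
    (h2 : q ≤ ((d : ℝ) - 2 + (d : ℝ) * Real.sqrt (2 * (d : ℝ) / ((d : ℝ) + 1)))
        / (((d : ℝ) - 1) * ((d : ℝ) + 2))) :
    q ≤ 1 ∧ ((d : ℝ) ^ 2 - 1) * q * q
        ≤ 1 + ((d : ℝ) - 2) * ((d : ℝ) + 1) / ((d : ℝ) + 2) * (q + q) := by
  have hd2 : (2 : ℝ) ≤ d := by exact_mod_cast hd
  have hm : (0 : ℝ) < (d : ℝ) - 1 := by linarith
  have hp2 : (0 : ℝ) < (d : ℝ) + 2 := by linarith
  have hp1 : (0 : ℝ) < (d : ℝ) + 1 := by linarith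
  have hr0 : 0 ≤ Real.sqrt (2 * (d : ℝ) / ((d : ℝ) + 1)) := Real.sqrt_nonneg _
  have hr2 : Real.sqrt (2 * (d : ℝ) / ((d : ℝ) + 1)) ^ 2 * ((d : ℝ) + 1) = 2 * d := by
    rw [Real.sq_sqrt (by positivity)]
    field_simp
  have hr1 : 1 ≤ Real.sqrt (2 * (d : ℝ) / ((d : ℝ) + 1)) := by
    rw [Real.one_le_sqrt, le_div_iff₀ hp1]
    linarith
  have hr3 : Real.sqrt (2 * (d : ℝ) / ((d : ℝ) + 1)) ≤ d := by
    rw [Real.sqrt_le_left (by linarith), div_le_iff₀ hp1]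
    nlinarith
  generalize Real.sqrt (2 * (d : ℝ) / ((d : ℝ) + 1)) = r at *
  rw [le_div_iff₀ (mul_pos hm hp2)] at h2
  rw [div_le_iff₀ (sq_sub_one_pos hd)] at h1
  -- Equivalent to `r ≤ d` at the upper end, as `(d-1)(d+2) - (d-2) = d²`.
  have hq : q ≤ 1 := by
    have : q * (((d : ℝ) - 1) * ((d : ℝ) + 2)) ≤ 1 * (((d : ℝ) - 1) * ((d : ℝ) + 2)) := by
      nlinarith
    exact le_of_mul_le_mul_right this (mul_pos hm hp2)
  refine ⟨hq, ?_⟩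
  -- The lower bound on `q` gives `q(d-1)(d+2) ≥ -2`, so the right-hand side is at least `-d`, and
  -- `r ≥ 1`.
  have hlow : -((d : ℝ) * r) ≤ q * (((d : ℝ) - 1) * ((d : ℝ) + 2)) - ((d : ℝ) - 2) := by
    have h3 : -1 ≤ (q * (((d : ℝ) - 1) * ((d : ℝ) + 1))) := by linarith
    have h4 : -1 ≤ q * ((d : ℝ) - 1) := by
      by_contra! hc
      nlinarith
    nlinarith
  have hsq : (q * (((d : ℝ) - 1) * ((d : ℝ) + 2)) - ((d : ℝ) - 2)) ^ 2 ≤ ((d : ℝ) * r) ^ 2 :=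
    sq_le_sq' hlow (by linarith)
  -- Completing the square in `q`: the threshold is the larger root of the curve restricted to `q₁ =
  -- q₂`.
  have e : (1 + ((d : ℝ) - 2) * ((d : ℝ) + 1) / ((d : ℝ) + 2) * (q + q)
      - ((d : ℝ) ^ 2 - 1) * q * q) * (((d : ℝ) - 1) * ((d : ℝ) + 2) ^ 2)
      = ((d : ℝ) + 1) * (((d : ℝ) * r) ^ 2
        - (q * (((d : ℝ) - 1) * ((d : ℝ) + 2)) - ((d : ℝ) - 2)) ^ 2) := by
    field_simp
    linear_combination (-(d : ℝ) ^ 2) * hr2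
  have hnn : 0 ≤ (1 + ((d : ℝ) - 2) * ((d : ℝ) + 1) / ((d : ℝ) + 2) * (q + q)
      - ((d : ℝ) ^ 2 - 1) * q * q) * (((d : ℝ) - 1) * ((d : ℝ) + 2) ^ 2) := by
    rw [e]
    exact mul_nonneg hp1.le (by linarith)
  have := nonneg_of_mul_nonneg_left hnn (by positivity)
  linarith

end Main

theorem mainTheorem5 (d : ℕ) (hd : 2 ≤ d) :
    (∀ q₁ q₂ : ℝ,
      -1 / ((d : ℝ) ^ 2 - 1) ≤ q₁ → q₁ ≤ 1 → -1 / ((d : ℝ) ^ 2 - 1) ≤ q₂ → q₂ ≤ 1 →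
      ((d : ℝ) ^ 2 - 1) * q₁ * q₂
        ≤ 1 + ((d : ℝ) - 2) * ((d : ℝ) + 1) / ((d : ℝ) + 2) * (q₁ + q₂) →
      (∃ μ p s₁ t₁ s₂ t₂ : ℝ, IsDepolarizingResolution d q₁ q₂ μ p s₁ t₁ s₂ t₂) ∧
      IsEntanglementAnnihilating (tensorMap (depolarizing d q₁) (depolarizing d q₂))) ∧
    (∀ q₁ q₂ s₁ s₂ : ℝ,
      -1 / ((d : ℝ) ^ 2 - 1) ≤ q₁ → q₁ < 1 → -1 / ((d : ℝ) ^ 2 - 1) ≤ q₂ → q₂ < 1 →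
      ((d : ℝ) ^ 2 - 1) * q₁ * q₂
        = 1 + ((d : ℝ) - 2) * ((d : ℝ) + 1) / ((d : ℝ) + 2) * (q₁ + q₂) →
      s₁ = 2 * ((d : ℝ) + 1) / ((d : ℝ) + 2) *
        ((((d : ℝ) + 1) * q₂ - q₁) / ((d : ℝ) + ((d : ℝ) + 1) * (q₂ - q₁))) →
      s₂ = 2 * ((d : ℝ) + 1) / ((d : ℝ) + 2) *
        ((((d : ℝ) + 1) * q₁ - q₂) / ((d : ℝ) + ((d : ℝ) + 1) * (q₁ - q₂))) →
      IsDepolarizingResolution d q₁ q₂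
        (1 / 2 + ((d : ℝ) + 1) / (2 * (d : ℝ)) * (q₂ - q₁))
        (1 / ((d : ℝ) + 1))
        s₁ (1 / ((d : ℝ) - 1) + (1 - 1 / ((d : ℝ) - 1)) * s₁)
        s₂ (1 / ((d : ℝ) - 1) + (1 - 1 / ((d : ℝ) - 1)) * s₂)) ∧
    (∀ q : ℝ,
      -1 / ((d : ℝ) ^ 2 - 1) ≤ q →
      q ≤ ((d : ℝ) - 2 + (d : ℝ) * Real.sqrt (2 * (d : ℝ) / ((d : ℝ) + 1)))
        / (((d : ℝ) - 1) * ((d : ℝ) + 2)) →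
      IsTwoLocallyEA (depolarizing d q)) := by
  have part1 : ∀ q₁ q₂ : ℝ,
      -1 / ((d : ℝ) ^ 2 - 1) ≤ q₁ → q₁ ≤ 1 → -1 / ((d : ℝ) ^ 2 - 1) ≤ q₂ → q₂ ≤ 1 →
      ((d : ℝ) ^ 2 - 1) * q₁ * q₂
        ≤ 1 + ((d : ℝ) - 2) * ((d : ℝ) + 1) / ((d : ℝ) + 2) * (q₁ + q₂) →
      (∃ μ p s₁ t₁ s₂ t₂ : ℝ, IsDepolarizingResolution d q₁ q₂ μ p s₁ t₁ s₂ t₂) ∧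
      IsEntanglementAnnihilating (tensorMap (depolarizing d q₁) (depolarizing d q₂)) := by
    intro q₁ q₂ h1 h1' h2 h2' h
    have hres := (hasResolutionParameters hd h1 h1' h2 h2' h).exists_isDepolarizingResolution hd
    obtain ⟨μ, p, s₁, t₁, s₂, t₂, hr⟩ := id hres
    exact ⟨hres, hr.isEntanglementAnnihilating hd h1 h1' h2 h2'⟩
  refine ⟨part1, ?_, ?_⟩
  · intro q₁ q₂ s₁ s₂ h1 h1' h2 h2' h hs₁ hs₂
    exact isDepolarizingResolution_curve hd h1 h1' h2 h2' h hs₁ hs₂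
  · intro q h1 h2
    obtain ⟨hq, h⟩ := le_curve_of_le_sqrt hd h1 h2
    exact ⟨⟨(hasKraus_depolarizing hd h1 hq).isCompletelyPositiveMap,
      trace_depolarizing (by omega) q⟩, (part1 q q h1 hq h1 hq h).2⟩
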